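/- **Theorem (Hamiltonian truncation).** Let $E$ be a complex Hilbert space and let $\mathcal N\ge 0$ modes or links $\nu=1,\dots,\mathcal N$ be given. Each $\nu$ carries a local quantum number, i.e. mutually orthogonal orthogonal projections $\Pi^{(\nu)}_\lambda$, $\lambda\in\mathbb Z$ (possibly $0$), with $\sum_\lambda\Pi^{(\nu)}_\lambda=I$ strongly. All $\Pi^{(\nu)}_\lambda$ commute with each other. Put $\Pi^{(\nu)}_{[-\Lambda,\Lambda]}=\sum_{|\lambda|\le\Lambda}\Pi^{(\nu)}_\lambda$ and $\Pi^{\rm all}_{[-\Lambda,\Lambda]}=\prod_\nu\Pi^{(\nu)}_{[-\Lambda,\Lambda]}$. Let $\chi>0$, $0\le r<1$, and let $H$ be a self-adjoint (in general unbounded) operator on $E$ such that for every $\nu$ there is a splitting $H=H_W^{(\nu)}+H_R^{(\nu)}$ into Hermitian operators (up to closure of the operator sum) with $$\Pi^{(\nu)}_\lambda H_W^{(\nu)}\Pi^{(\nu)}_{\lambda'}=0\ \ (|\lambda-\lambda'|>1),\qquad \|H_W^{(\nu)}\Pi^{(\nu)}_{[-\Lambda,\Lambda]}\|\le\chi(\Lambda+1)^r\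 \ (\Lambda=0,1,2,\dots),\qquad [H_R^{(\nu)},\Pi^{(\nu)}_\lambda]=0 .$$ For integers $\widetilde\Lambda>\Lambda_0\ge0$ such that the range of $\Pi^{\rm all}_{[-\widetilde\Lambda,\widetilde\Lambda]}$ lies in the domain of $H$, set $$\widetilde H=\Pi^{\rm all}_{[-\widetilde\Lambda,\widetilde\Lambda]}\,H\,\Pi^{\rm all}_{[-\widetilde\Lambda,\widetilde\Lambda]},\qquad \mathcal A(\widetilde\Lambda)=\|[H,\widetilde H]\| .$$ (i) There are an absolute constant $c>0$ and a polynomial $p$ in three variables, independent of all the data ($E,\mathcal N,\chi,r,H,\dots$), such that for all such data and all $t\in\mathbb R$ $$\big\|(e^{-it\widetilde H}-e^{-itH})\Pi^{\rm all}_{[-\Lambda_0,\Lambda_0]}\big\|\le\sqrt{\mathcal N}\,\mathcal A(\widetilde\Lambda)\,t^2\,p(\chi|t|,\Lambda_0,\widetilde\Lambda)\,\exp\!\Big(-c\,\frac{\widetilde\Lambda^{1-r}-\Lambda_0^{1-r}}{4(1-r)\chi|t|+1}\Big).$$ (ii) Consequently, a threshold polylogarithmic in $N/\epsilon$ suffices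 when $\mathcal A$ is polynomial: for every $0\le r<1$, $\kappa\in\mathbb R$ and real polynomial $q$ in two variables there are $C>0$ and $k\in\mathbb N$, depending only on $r,\kappa,q$, such that for all data as above with $\mathcal N\le\kappa N$ (with $N\in\mathbb N$ the system size), all $T\ge0$, $\epsilon>0$, and all integers $\Lambda_0,\widetilde\Lambda\ge0$ such that the range of $\Pi^{\rm all}_{[-\widetilde\Lambda,\widetilde\Lambda]}$ lies in the domain of $H$: if $\mathcal A(\widetilde\Lambda)\le \max(q(N,\widetilde\Lambda),0)$ and $$\widetilde\Lambda^{1-r}\ \ge\ \Lambda_0^{1-r}+C(\chi T+1)\,\log^k\!\Big(2+\frac N\epsilon+\Lambda_0+T+\chi T\Big),$$ then $\|(e^{-it\widetilde H}-e^{-itH})\Pi^{\rm all}_{[-\Lambda_0,\Lambda_0]}\|\le\epsilon$ for all $|t|\le T$. -/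

import Mathlib

noncomputable section

namespace HamTrunc

section Operators

variable {E : Type*} [NormedAddCommGroup E] [InnerProductSpace ℂ E]

/-- The product `A B` of two partially defined operators, with its natural domain
`{ψ ∈ D(B) | B ψ ∈ D(A)}`. -/
def pcomp (A B : E →ₗ.[ℂ] E) : E →ₗ.[ℂ] E :=
  A.comp (B.domRestrict ((A.domain.comap B.toFun).map B.domain.subtype)) (by
    rintro ⟨x, hx, hxB⟩
    obtain ⟨y, hy, rfl⟩ := hx
    exact hy)

theorem mem_pcomp_domain {A B : E →ₗ.[ℂ] E} {x : E} :
    x ∈ (pcomp A B).domain ↔ ∃ h : x ∈ B.domain, B ⟨x, h⟩ ∈ A.domain := by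
  constructor
  · rintro ⟨⟨y, hy, rfl⟩, hxB⟩
    exact ⟨hxB, hy⟩
  · rintro ⟨h, h'⟩
    exact ⟨⟨⟨x, h⟩, h', rfl⟩, h⟩

theorem pcomp_apply {A B : E →ₗ.[ℂ] E} {x : E} (hx : x ∈ (pcomp A B).domain)
    (h : x ∈ B.domain) (h' : B ⟨x, h⟩ ∈ A.domain) :
    pcomp A B ⟨x, hx⟩ = A ⟨B ⟨x, h⟩, h'⟩ := rfl

/-- The commutator `[A, B] = A B - B A`, on its natural domain `D(A B) ∩ D(B A)`. -/
def pcomm (A B : E →ₗ.[ℂ] E) : E →ₗ.[ℂ] E := pcomp A B - pcomp B A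

/-- The spectral (operator) norm of a partially defined operator: the supremum of `‖A ψ‖` over
`ψ ∈ D(A)` with `‖ψ‖ ≤ 1`; it is `∞` exactly when `A` is unbounded. -/
def pnorm (A : E →ₗ.[ℂ] E) : ENNReal :=
  ⨆ (ψ : A.domain) (_ : ‖(ψ : E)‖ ≤ 1), ‖A ψ‖ₑ

/-- The truncation `P H P` of `H`, with its natural domain `{ψ | P ψ ∈ D(H)}`. -/
def truncated (P : E →L[ℂ] E) (H : E →ₗ.[ℂ] E) : E →ₗ.[ℂ] E :=
  pcomp ((P : E →ₗ[ℂ] E).toPMap ⊤) (pcomp H ((P : E →ₗ[ℂ] E).toPMap ⊤))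

/-- `IsEvolution H U` says that `U t = e^{-itH}` for all `t`: `U` is the strongly continuous
one-parameter unitary group whose infinitesimal generator is exactly `-iH`, i.e. `t ↦ U t ψ` is
differentiable at `0` if and only if `ψ ∈ D(H)`, and then its derivative there is `-i H ψ`. -/
structure IsEvolution [CompleteSpace E] (H : E →ₗ.[ℂ] E) (U : ℝ → E →L[ℂ] E) : Prop where
  unitary : ∀ t, U t ∈ unitary (E →L[ℂ] E)
  zero : U 0 = 1
  add : ∀ s t, U (s + t) = U s * U t
  continuous : ∀ ψ, Continuous fun t => U t ψ
  generator : ∀ ψ φ : E, HasDerivAt (fun t => U t ψ) φ 0 ↔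
    ∃ h : ψ ∈ H.domain, φ = -Complex.I • H ⟨ψ, h⟩

end Operators

/-- A local quantum number with values in `ℤ`: a decomposition of the Hilbert space `E` into
mutually orthogonal closed subspaces `V_k`, `k ∈ ℤ` (possibly zero), given by the orthogonal
projections `proj k` onto them, with `∑ k, proj k = I` strongly. -/
structure QuantumNumber (E : Type*) [NormedAddCommGroup E] [InnerProductSpace ℂ E]
    [CompleteSpace E] where
  proj : ℤ → E →L[ℂ] E
  isStarProjection : ∀ k, IsStarProjection (proj k)
  orthogonal : ∀ k l, k ≠ l → proj k * proj l = 0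
  hasSum : ∀ ψ, HasSum (fun k => proj k ψ) ψ

section Framework

variable {E : Type*} [NormedAddCommGroup E] [InnerProductSpace ℂ E] [CompleteSpace E]

/-- `Π_{[-Λ, Λ]}`, the projection onto quantum numbers of absolute value at most `Λ`. -/
def QuantumNumber.window (Q : QuantumNumber E) (Λ : ℕ) : E →L[ℂ] E :=
  ∑ k ∈ Finset.Icc (-(Λ : ℤ)) Λ, Q.proj k

/-- `Π^all_{[-Λ, Λ]}`, the product of the projections `Π^{(ν)}_{[-Λ, Λ]}` over all `ν`. -/
def windowAll {n : ℕ} (Q : Fin n → QuantumNumber E) (Λ : ℕ) : E →L[ℂ] E :=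
  (List.ofFn fun ν => (Q ν).window Λ).prod

/-- `H = H_W + H_R` with Hermitian `H_W`, `H_R` (the sum of unbounded operators being understood
as the closure of the sum on `D(H_W) ∩ D(H_R)`), where
* `Π_k H_W Π_l = 0` for `|k - l| > 1`;
* `‖H_W Π_{[-Λ, Λ]}‖ ≤ χ (Λ + 1) ^ r` for all `Λ` (so `H_W Π_{[-Λ, Λ]}` is defined everywhere);
* `[H_R, Π_k] = 0`, i.e. `Π_k` maps `D(H_R)` into itself and commutes with `H_R` there. -/
structure IsWalkDecomposition (Q : QuantumNumber E) (χ r : ℝ) (H HW HR : E →ₗ.[ℂ] E) :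
    Prop where
  hermitian_walk : HW.IsFormalAdjoint HW
  hermitian_rest : HR.IsFormalAdjoint HR
  sum : H = (HW + HR).closure
  walk : ∀ k l : ℤ, 1 < |k - l| → ∀ (ψ : E) (h : Q.proj l ψ ∈ HW.domain),
    Q.proj k (HW ⟨Q.proj l ψ, h⟩) = 0
  bound : ∀ (Λ : ℕ) (ψ : E), ∃ h : Q.window Λ ψ ∈ HW.domain,
    ‖HW ⟨Q.window Λ ψ, h⟩‖ ≤ χ * ((Λ : ℝ) + 1) ^ r * ‖ψ‖
  rest : ∀ (k : ℤ) (ψ : HR.domain), ∃ h : Q.proj k ψ ∈ HR.domain,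
    HR ⟨Q.proj k ψ, h⟩ = Q.proj k (HR ψ)

/-- The framework for a Hamiltonian with modes or links `ν : Fin n`: `H` is self-adjoint, the
spectral projections of all local quantum numbers commute, and for each `ν` there is a splitting
`H = H_W^{(ν)} + H_R^{(ν)}` with the common parameters `χ` and `r`. -/
structure IsModel {n : ℕ} (Q : Fin n → QuantumNumber E) (χ r : ℝ) (H : E →ₗ.[ℂ] E) :
    Prop where
  selfAdjoint : IsSelfAdjoint H
  commute : ∀ μ ν k l, Commute ((Q μ).proj k) ((Q ν).proj l)
  decomposition : ∀ ν, ∃ HW HR : E →ₗ.[ℂ] E, IsWalkDecomposition (Q ν) χ r H HW HR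

/-- The truncated Hamiltonian `H̃ = Π^all_{[-Λ, Λ]} H Π^all_{[-Λ, Λ]}`. -/
def truncatedHamiltonian {n : ℕ} (Q : Fin n → QuantumNumber E) (H : E →ₗ.[ℂ] E) (Λ : ℕ) :
    E →ₗ.[ℂ] E :=
  truncated (windowAll Q Λ) H

/-- `𝒜(Λ) = ‖[H, Π^all_{[-Λ, Λ]} H Π^all_{[-Λ, Λ]}]‖`. -/
def commutatorNorm {n : ℕ} (Q : Fin n → QuantumNumber E) (H : E →ₗ.[ℂ] E) (Λ : ℕ) : ENNReal :=
  pnorm (pcomm H (truncatedHamiltonian Q H Λ))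

end Framework

end HamTrunc

end

universe u

/-!
The proof combines Duhamel's formula with an exponentially weighted energy estimate.

Write `P` for the projection onto `[-Λ, Λ]` in all modes and `H̃ = P H P`. By the closed graph
theorem `H P`, and hence `H̃`, is bounded (`mulRight`, `compression`). Each splitting
`H = H_W + H_R` shows that `H` moves every quantum number by at most one
(`IsModel.intWindowAll_succ_of_mem_graph`). Therefore `H - H̃` vanishes on vectors supported one
step inside the window, and `[H, H̃]` on vectors supported two steps inside.

With `V` the evolution of `H̃` and `U` that of `H`, the derivative of `U (-s) V s ψ` is
`i U (-s) (H - H̃) V s ψ`, while `V (-s) (H - H̃) V s ψ` vanishes at `s = 0` and has derivative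
`-i V (-s) [H, H̃] V s ψ`. In the last expression only the part of `V s ψ` outside `[-(Λ-2), Λ-2]`
contributes, so two applications of the mean value inequality bound the truncation error by
`t²` times the norm of the commutator times the leakage of the truncated evolution
(`IsModel.norm_sub_apply_le`). The factor `√n` comes from summing the squared leakages of the
modes (`norm_sq_sub_ofFn_prod_le`).

The leakage in one mode is controlled by `M = ∑ k, exp (2 a (|k| + 1) ^ (1 - r)) ‖Π_k V s ψ‖²`.
In its derivative `H_R` drops out, because it commutes with all `Π_k`, and what remains is a sum of
currents between neighbouring `k`, multiplied by the differences of the weights. These differences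
are of order `a (1 - r) (|k| + 1) ^ (-r)` relative to the weights, which cancels the growth
`χ (|k| + 1) ^ r` of `H_W`. Hence `|M'| ≤ 6 a (1 - r) χ M`, and the choice
`a = 1 / (4 (1 - r) χ |t| + 1)` keeps the Grönwall factor bounded up to time `t` while the weights
give the decay `exp (-a (Λ ^ (1 - r) - Λ₀ ^ (1 - r)))` (`IsModel.norm_sub_intWindow_le`). Thus the
first part holds with `c = 1` and a constant polynomial.

For the second part a single power of the logarithm suffices (`exists_threshold`): the decay beats
every power of `2 + N / ε + Λ₀ + T + χ T` and of the excess of `Λ ^ (1 - r)` over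
`Λ₀ ^ (1 - r)`, and `Λ` itself is bounded by a polynomial in these two quantities.
-/

open Filter Topology

namespace HamTrunc

/-! ### Products of commuting projections -/

section Projections

variable {E : Type*} [NormedAddCommGroup E] [InnerProductSpace ℂ E] [CompleteSpace E]

theorem inner_starProjection_left {p : E →L[ℂ] E} (hp : IsStarProjection p) (x y : E) :
    inner ℂ (p x) y = inner ℂ x (p y) := by
  have h := hp.isSelfAdjoint.star_eq
  rw [ContinuousLinearMap.star_eq_adjoint] at h
  rw [← ContinuousLinearMap.adjoint_inner_right, h]

theorem starProjection_idem {p : E →L[ℂ] E} (hp : IsStarProjection p) (x : E) :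
    p (p x) = p x :=
  DFunLike.congr_fun hp.isIdempotentElem.eq x

theorem norm_sq_starProjection {p : E →L[ℂ] E} (hp : IsStarProjection p) (x : E) :
    ‖p x‖ ^ 2 = (inner ℂ x (p x)).re := by
  rw [← starProjection_idem hp x, ← inner_starProjection_left hp, starProjection_idem hp,
    ← inner_self_eq_norm_sq (𝕜 := ℂ)]
  rfl

theorem norm_sq_sub_starProjection {p : E →L[ℂ] E} (hp : IsStarProjection p) (x : E) :
    ‖x - p x‖ ^ 2 + ‖p x‖ ^ 2 = ‖x‖ ^ 2 := by
  have h := norm_sub_sq (𝕜 := ℂ) x (p x)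
  have h' := norm_sq_starProjection hp x
  simp only [RCLike.re_to_complex] at h
  linarith

theorem norm_starProjection_apply_le {p : E →L[ℂ] E} (hp : IsStarProjection p) (x : E) :
    ‖p x‖ ≤ ‖x‖ := by
  have := norm_sq_sub_starProjection hp x
  exact le_of_sq_le_sq (by nlinarith [sq_nonneg ‖x - p x‖]) (norm_nonneg _)

omit [CompleteSpace E] in
theorem commute_apply {a b : E →L[ℂ] E} (h : Commute a b) (x : E) : a (b x) = b (a x) :=
  DFunLike.congr_fun h.eq x

/-- The product of a list of commuting orthogonal projections is an orthogonal projection. -/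
theorem isStarProjection_listProd (L : List (E →L[ℂ] E)) (hL : ∀ p ∈ L, IsStarProjection p)
    (hc : ∀ p ∈ L, ∀ q ∈ L, Commute p q) : IsStarProjection L.prod := by
  induction L with
  | nil => exact IsStarProjection.one _
  | cons p L ih =>
    rw [List.prod_cons]
    refine (hL p (by simp)).mul (ih (fun q hq => hL q (by simp [hq]))
      fun q hq q' hq' => hc q (by simp [hq]) q' (by simp [hq'])) ?_
    exact Commute.list_prod_right _ _ fun q hq => hc p (by simp) q (by simp [hq])

/-- The product of commuting orthogonal projections fixes exactly the vectors fixed by all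
factors. -/
theorem listProd_apply_eq_self_iff (L : List (E →L[ℂ] E)) (hL : ∀ p ∈ L, IsStarProjection p)
    (hc : ∀ p ∈ L, ∀ q ∈ L, Commute p q) (x : E) : L.prod x = x ↔ ∀ p ∈ L, p x = x := by
  induction L with
  | nil => simp
  | cons p L ih =>
    have ih := ih (fun q hq => hL q (by simp [hq]))
      fun q hq q' hq' => hc q (by simp [hq]) q' (by simp [hq'])
    have hp := hL p (by simp)
    have hcomm : Commute p L.prod :=
      Commute.list_prod_right _ _ fun q hq => hc p (by simp) q (by simp [hq])
    have hLp := isStarProjection_listProd L (fun q hq => hL q (by simp [hq]))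
      fun q hq q' hq' => hc q (by simp [hq]) q' (by simp [hq'])
    rw [List.prod_cons, List.forall_mem_cons, ← ih]
    change p (L.prod x) = x ↔ _
    constructor
    · intro h
      constructor
      · rw [← h, starProjection_idem hp]
      · rw [← h, commute_apply hcomm, starProjection_idem hLp]
    · rintro ⟨h1, h2⟩
      rw [h2, h1]

/-- Union bound for leakage: the squared weight outside the product of projections is at most the
sum of the squared weights outside the factors. -/
theorem norm_sq_sub_ofFn_prod_le {n : ℕ} (p : Fin n → E →L[ℂ] E)
    (hp : ∀ ν, IsStarProjection (p ν)) (x : E) :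
    ‖x - (List.ofFn p).prod x‖ ^ 2 ≤ ∑ ν, ‖x - p ν x‖ ^ 2 := by
  induction n with
  | zero => simp
  | succ n ih =>
    rw [List.ofFn_succ, List.prod_cons, Fin.sum_univ_succ]
    set R := (List.ofFn fun i => p (Fin.succ i)).prod with hR
    have ih := ih (fun i => p (Fin.succ i)) fun i => hp _
    have h0 := hp 0
    have key : ‖x - (p 0 * R) x‖ ^ 2 = ‖x - p 0 x‖ ^ 2 + ‖p 0 (x - R x)‖ ^ 2 := by
      have h := norm_sq_sub_starProjection h0 (x - (p 0 * R) x)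
      have e1 : p 0 (x - (p 0 * R) x) = p 0 (x - R x) := by
        rw [map_sub, map_sub]
        change p 0 x - p 0 (p 0 (R x)) = _
        rw [starProjection_idem h0]
      have e2 : x - (p 0 * R) x - p 0 (x - R x) = x - p 0 x := by
        rw [map_sub]
        change x - p 0 (R x) - _ = _
        abel
      rw [e1, e2] at h
      exact h.symm
    rw [key]
    have := norm_starProjection_apply_le h0 (x - R x)
    have := pow_le_pow_left₀ (norm_nonneg _) this 2
    linarith

end Projections

/-! ### Windows of quantum numbers -/

section QuantumNumbers

variable {E : Type*} [NormedAddCommGroup E] [InnerProductSpace ℂ E] [CompleteSpace E]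

namespace QuantumNumber

variable (Q : QuantumNumber E)

/-- The projection onto quantum numbers in `[-z, z]`, for an integer `z`; it vanishes if
`z < 0`. -/
noncomputable def intWindow (z : ℤ) : E →L[ℂ] E := ∑ k ∈ Finset.Icc (-z) z, Q.proj k

theorem window_eq_intWindow (Λ : ℕ) : Q.window Λ = Q.intWindow Λ := rfl

theorem proj_proj (k l : ℤ) (x : E) : Q.proj k (Q.proj l x) = if k = l then Q.proj k x else 0 := by
  split_ifs with h
  · subst h
    exact starProjection_idem (Q.isStarProjection k) x
  · exact DFunLike.congr_fun (Q.orthogonal k l h) x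

theorem intWindow_apply (z : ℤ) (x : E) :
    Q.intWindow z x = ∑ k ∈ Finset.Icc (-z) z, Q.proj k x := by
  simp [intWindow]

theorem proj_intWindow (k z : ℤ) (x : E) :
    Q.proj k (Q.intWindow z x) = if |k| ≤ z then Q.proj k x else 0 := by
  rw [intWindow_apply, map_sum]
  simp_rw [proj_proj]
  rw [Finset.sum_ite_eq]
  simp [abs_le]

theorem ext_proj {x y : E} (h : ∀ k, Q.proj k x = Q.proj k y) : x = y :=
  (Q.hasSum x).unique (by simpa [h] using Q.hasSum y)

theorem intWindow_eq_self_iff (z : ℤ) (x : E) :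
    Q.intWindow z x = x ↔ ∀ k, z < |k| → Q.proj k x = 0 := by
  constructor
  · intro h k hk
    rw [← h, proj_intWindow, if_neg (not_le.2 hk)]
  · intro h
    refine Q.ext_proj fun k => ?_
    rw [proj_intWindow]
    split_ifs with hk
    · rfl
    · exact (h k (not_le.1 hk)).symm

theorem window_natAbs_proj (k : ℤ) (x : E) :
    Q.window k.natAbs (Q.proj k x) = Q.proj k x := by
  rw [Q.window_eq_intWindow, Q.intWindow_eq_self_iff]
  intro l hl
  rw [Q.proj_proj, if_neg]
  rintro rfl
  simp at hl

theorem isStarProjection_intWindow (z : ℤ) : IsStarProjection (Q.intWindow z) where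
  isIdempotentElem := by
    ext x
    change Q.intWindow z (Q.intWindow z x) = _
    rw [intWindow_eq_self_iff]
    intro k hk
    rw [proj_intWindow, if_neg (not_le.2 hk)]
  isSelfAdjoint := by
    rw [intWindow]
    exact isSelfAdjoint_sum _ fun k _ => (Q.isStarProjection k).isSelfAdjoint

theorem norm_sq_intWindow (z : ℤ) (x : E) :
    ‖Q.intWindow z x‖ ^ 2 = ∑ k ∈ Finset.Icc (-z) z, ‖Q.proj k x‖ ^ 2 := by
  rw [norm_sq_starProjection (Q.isStarProjection_intWindow z), intWindow_apply, inner_sum,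
    Complex.re_sum]
  exact Finset.sum_congr rfl fun k _ => (norm_sq_starProjection (Q.isStarProjection k) x).symm

end QuantumNumber

/-- The projection onto the vectors all of whose quantum numbers lie in `[-z, z]`, for an
integer `z`. -/
noncomputable def intWindowAll {n : ℕ} (Q : Fin n → QuantumNumber E) (z : ℤ) : E →L[ℂ] E :=
  (List.ofFn fun ν => (Q ν).intWindow z).prod

variable {n : ℕ} {Q : Fin n → QuantumNumber E}

theorem commute_intWindow (hc : ∀ μ ν k l, Commute ((Q μ).proj k) ((Q ν).proj l))
    (μ ν : Fin n) (y z : ℤ) : Commute ((Q μ).intWindow y) ((Q ν).intWindow z) :=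
  Commute.sum_left _ _ _ fun k _ => Commute.sum_right _ _ _ fun l _ => hc μ ν k l

theorem commute_proj_intWindowAll (hc : ∀ μ ν k l, Commute ((Q μ).proj k) ((Q ν).proj l))
    (ν : Fin n) (k z : ℤ) : Commute ((Q ν).proj k) (intWindowAll Q z) := by
  refine Commute.list_prod_right _ _ fun q hq => ?_
  obtain ⟨μ, rfl⟩ := List.mem_ofFn.1 hq
  exact Commute.sum_right _ _ _ fun l _ => hc ν μ k l

theorem isStarProjection_intWindowAll (hc : ∀ μ ν k l, Commute ((Q μ).proj k) ((Q ν).proj l))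
    (z : ℤ) : IsStarProjection (intWindowAll Q z) := by
  refine isStarProjection_listProd _ (fun p hp => ?_) fun p hp q hq => ?_
  · obtain ⟨μ, rfl⟩ := List.mem_ofFn.1 hp
    exact (Q μ).isStarProjection_intWindow z
  · obtain ⟨μ, rfl⟩ := List.mem_ofFn.1 hp
    obtain ⟨ν, rfl⟩ := List.mem_ofFn.1 hq
    exact commute_intWindow hc _ _ _ _

theorem intWindowAll_eq_self_iff (hc : ∀ μ ν k l, Commute ((Q μ).proj k) ((Q ν).proj l))
    (z : ℤ) (x : E) :
    intWindowAll Q z x = x ↔ ∀ ν k, z < |k| → (Q ν).proj k x = 0 := by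
  rw [intWindowAll, listProd_apply_eq_self_iff]
  · rw [List.forall_mem_ofFn_iff]
    exact forall_congr' fun ν => (Q ν).intWindow_eq_self_iff z x
  · intro p hp
    obtain ⟨μ, rfl⟩ := List.mem_ofFn.1 hp
    exact (Q μ).isStarProjection_intWindow z
  · intro p hp q hq
    obtain ⟨μ, rfl⟩ := List.mem_ofFn.1 hp
    obtain ⟨ν, rfl⟩ := List.mem_ofFn.1 hq
    exact commute_intWindow hc _ _ _ _

theorem intWindowAll_mono (hc : ∀ μ ν k l, Commute ((Q μ).proj k) ((Q ν).proj l))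
    {y z : ℤ} (hyz : y ≤ z) {x : E} (hx : intWindowAll Q y x = x) : intWindowAll Q z x = x := by
  rw [intWindowAll_eq_self_iff hc] at hx ⊢
  exact fun ν k hk => hx ν k (hyz.trans_lt hk)

end QuantumNumbers

/-! ### Splittings into a walk term and a conserving term -/

section Walk

variable {E : Type*} [NormedAddCommGroup E] [InnerProductSpace ℂ E] [CompleteSpace E]

omit [CompleteSpace E] in
/-- The value of a partially defined operator at a point of its graph. -/
theorem apply_eq_of_mem_graph {A : E →ₗ.[ℂ] E} {x y : E} (h : (x, y) ∈ A.graph)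
    (hx : x ∈ A.domain) : A ⟨x, hx⟩ = y :=
  A.mem_graph_snd_inj (A.mem_graph ⟨x, hx⟩) h rfl

omit [CompleteSpace E] in
theorem exists_seq_of_mem_graph_closure {A : E →ₗ.[ℂ] E} {x y : E}
    (h : (x, y) ∈ A.closure.graph) :
    ∃ u : ℕ → A.domain, Tendsto (fun m => (u m : E)) atTop (𝓝 x) ∧
      Tendsto (fun m => A (u m)) atTop (𝓝 y) := by
  by_cases hA : A.IsClosable
  · rw [← hA.graph_closure_eq_closure_graph] at h
    have h' : (x, y) ∈ closure (A.graph : Set (E × E)) := h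
    obtain ⟨u, hu, hlim⟩ := mem_closure_iff_seq_limit.1 h'
    choose v hv using fun m => A.mem_graph_iff.1 (hu m)
    rw [nhds_prod_eq] at hlim
    refine ⟨v, ?_, ?_⟩
    · simpa only [(hv _).1] using hlim.fst
    · simpa only [(hv _).2] using hlim.snd
  · rw [LinearPMap.closure_def' hA] at h
    obtain ⟨v, hv1, hv2⟩ := A.mem_graph_iff.1 h
    refine ⟨fun _ => v, ?_, ?_⟩
    · simpa using hv1
    · simpa using hv2

namespace IsWalkDecomposition

variable {Q : QuantumNumber E} {χ r : ℝ} {H HW HR : E →ₗ.[ℂ] E}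
  (D : IsWalkDecomposition Q χ r H HW HR)
include D

theorem proj_mem_domain (k : ℤ) (x : E) : Q.proj k x ∈ HW.domain := by
  obtain ⟨h, -⟩ := D.bound k.natAbs (Q.proj k x)
  rwa [Q.window_natAbs_proj] at h

theorem norm_walk_proj_le (k : ℤ) (x : E) :
    ‖HW ⟨Q.proj k x, D.proj_mem_domain k x⟩‖ ≤ χ * (|(k : ℝ)| + 1) ^ r * ‖Q.proj k x‖ := by
  obtain ⟨h, hb⟩ := D.bound k.natAbs (Q.proj k x)
  simp only [Q.window_natAbs_proj] at hb
  rwa [Nat.cast_natAbs, Int.cast_abs] at hb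

/-- The bounded operator `H_W Π_k`. -/
noncomputable def walkProj (k : ℤ) : E →L[ℂ] E :=
  LinearMap.mkContinuous
    (HW.toFun ∘ₗ (Q.proj k : E →ₗ[ℂ] E).codRestrict HW.domain (D.proj_mem_domain k))
    (|χ * (|(k : ℝ)| + 1) ^ r|) fun x =>
      (D.norm_walk_proj_le k x).trans <| by
        gcongr
        · exact le_abs_self _
        · exact norm_starProjection_apply_le (Q.isStarProjection k) x

theorem walkProj_apply (k : ℤ) (x : E) :
    D.walkProj k x = HW ⟨Q.proj k x, D.proj_mem_domain k x⟩ := rfl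

theorem norm_walkProj_le (k : ℤ) (x : E) :
    ‖D.walkProj k x‖ ≤ χ * (|(k : ℝ)| + 1) ^ r * ‖Q.proj k x‖ :=
  D.norm_walk_proj_le k x

theorem proj_walkProj_eq_zero {k l : ℤ} (h : 1 < |k - l|) (x : E) :
    Q.proj k (D.walkProj l x) = 0 :=
  D.walk k l h x _

/-- The operator `Π_k H_W` on `D(H_W)` is a restriction of the adjoint of `H_W Π_k`, hence
bounded. -/
theorem walkProj_of_mem_domain (k : ℤ) {x : E} (hx : x ∈ HW.domain) (y : E) :
    inner ℂ (D.walkProj k y) x = inner ℂ y (Q.proj k (HW ⟨x, hx⟩)) := by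
  rw [← inner_starProjection_left (Q.isStarProjection k), walkProj_apply]
  exact D.hermitian_walk ⟨_, D.proj_mem_domain k y⟩ ⟨x, hx⟩

/-- Matrix elements of `H_W` form a Hermitian matrix. -/
theorem inner_walkProj_proj (k l : ℤ) (x y : E) :
    inner ℂ (D.walkProj k x) (Q.proj l y) = inner ℂ (Q.proj k x) (D.walkProj l y) :=
  D.hermitian_walk ⟨_, D.proj_mem_domain k x⟩ ⟨_, D.proj_mem_domain l y⟩

/-- Approximation of a vector in the domain of `H` by vectors on which both parts of the splitting
are defined. -/
theorem exists_seq {x y : E} (h : (x, y) ∈ H.graph) :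
    ∃ (u : ℕ → E) (hW : ∀ m, u m ∈ HW.domain) (hR : ∀ m, u m ∈ HR.domain),
      Tendsto u atTop (𝓝 x) ∧
      Tendsto (fun m => HW ⟨u m, hW m⟩ + HR ⟨u m, hR m⟩) atTop (𝓝 y) := by
  rw [D.sum] at h
  obtain ⟨u, hu1, hu2⟩ := exists_seq_of_mem_graph_closure h
  exact ⟨fun m => u m, fun m => (u m).2.1, fun m => (u m).2.2, hu1, hu2⟩

theorem mem_graph_of_add {x : E} (hW : x ∈ HW.domain) (hR : x ∈ HR.domain) :
    (x, HW ⟨x, hW⟩ + HR ⟨x, hR⟩) ∈ H.graph := by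
  have h := LinearPMap.le_graph_of_le (LinearPMap.le_closure (HW + HR))
    ((HW + HR).mem_graph ⟨x, hW, hR⟩)
  rw [← D.sum] at h
  exact h

/-- Since `H_R` commutes with `Π_k`, the commutator of `H` and `Π_k` is the bounded operator
`H_W Π_k - (H_W Π_k)^*`. -/
theorem proj_mem_graph (hH : IsSelfAdjoint H) (k : ℤ) {x y : E} (h : (x, y) ∈ H.graph) :
    (Q.proj k x, D.walkProj k x + (Q.proj k y - (D.walkProj k).adjoint x)) ∈ H.graph := by
  obtain ⟨u, hW, hR, hu, hlim⟩ := D.exists_seq h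
  have hcl : IsClosed (H.graph : Set (E × E)) := hH.isClosed
  have hW' : ∀ m, Q.proj k (HW ⟨u m, hW m⟩) = (D.walkProj k).adjoint (u m) := fun m => by
    refine ext_inner_left ℂ fun z => ?_
    rw [ContinuousLinearMap.adjoint_inner_right, D.walkProj_of_mem_domain k (hW m)]
  refine hcl.mem_of_tendsto (f := fun m => (Q.proj k (u m), D.walkProj k (u m) +
    (Q.proj k (HW ⟨u m, hW m⟩ + HR ⟨u m, hR m⟩) - (D.walkProj k).adjoint (u m)))) (b := atTop)
    ?_ (Eventually.of_forall fun m => ?_)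
  · refine Tendsto.prodMk_nhds (((Q.proj k).continuous.tendsto _).comp hu) ?_
    exact (((D.walkProj k).continuous.tendsto _).comp hu).add
      ((((Q.proj k).continuous.tendsto _).comp hlim).sub
        (((D.walkProj k).adjoint.continuous.tendsto _).comp hu))
  · obtain ⟨h1, h2⟩ := D.rest k ⟨u m, hR m⟩
    have h3 := D.mem_graph_of_add (D.proj_mem_domain k (u m)) h1
    rw [h2] at h3
    simp only [map_add, hW', add_sub_cancel_left, SetLike.mem_coe]
    exact h3

/-- `H` changes the quantum number by at most one. -/
theorem proj_eq_zero_of_mem_graph (hH : IsSelfAdjoint H) {z : ℤ} {x y : E}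
    (h : (x, y) ∈ H.graph) (hx : ∀ k, z < |k| → Q.proj k x = 0) {k : ℤ} (hk : z + 1 < |k|) :
    Q.proj k y = 0 := by
  have hk' : Q.proj k x = 0 := hx k (by lia)
  have h0 : D.walkProj k x = 0 := by
    simp only [walkProj_apply, hk']
    exact HW.map_zero
  have hadj : (D.walkProj k).adjoint x = 0 := by
    refine ext_inner_left ℂ fun v => ?_
    rw [ContinuousLinearMap.adjoint_inner_right, inner_zero_right]
    refine (Q.hasSum x).mapL (innerSL ℂ (D.walkProj k v)) |>.unique ?_
    convert hasSum_zero with l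
    rw [innerSL_apply_apply]
    by_cases hl : z < |l|
    · rw [hx l hl, inner_zero_right]
    · rw [← inner_starProjection_left (Q.isStarProjection l), D.proj_walkProj_eq_zero,
        inner_zero_left]
      have := abs_sub_abs_le_abs_sub k l
      rw [abs_sub_comm]
      lia
  have h1 := D.proj_mem_graph hH k h
  rw [hk', h0, hadj, zero_add, sub_zero] at h1
  exact H.graph_fst_eq_zero_snd h1 rfl

/-- The part `H_R` does not contribute to the current into a quantum number, because it commutes
with `Π_k`. -/
theorem im_inner_proj_of_mem_graph (k : ℤ) {x y : E} (h : (x, y) ∈ H.graph) :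
    (inner ℂ (Q.proj k x) y).im = (inner ℂ (D.walkProj k x) x).im := by
  obtain ⟨u, hW, hR, hu, hlim⟩ := D.exists_seq h
  have h1 : Tendsto (fun m => (inner ℂ (Q.proj k (u m))
      (HW ⟨u m, hW m⟩ + HR ⟨u m, hR m⟩)).im) atTop (𝓝 (inner ℂ (Q.proj k x) y).im) :=
    (Complex.continuous_im.tendsto _).comp
      ((((Q.proj k).continuous.tendsto _).comp hu).inner hlim)
  have h2 : Tendsto (fun m => (inner ℂ (D.walkProj k (u m)) (u m)).im) atTop
      (𝓝 (inner ℂ (D.walkProj k x) x).im) :=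
    (Complex.continuous_im.tendsto _).comp
      ((((D.walkProj k).continuous.tendsto _).comp hu).inner hu)
  refine tendsto_nhds_unique h1 (h2.congr fun m => ?_)
  obtain ⟨h3, h4⟩ := D.rest k ⟨u m, hR m⟩
  have e1 : inner ℂ (D.walkProj k (u m)) (u m)
      = inner ℂ (Q.proj k (u m)) (HW ⟨u m, hW m⟩) := by
    rw [D.walkProj_of_mem_domain k (hW m), inner_starProjection_left (Q.isStarProjection k)]
  have e2 : (inner ℂ (Q.proj k (u m)) (HR ⟨u m, hR m⟩)).im = 0 := by
    have e3 : inner ℂ (Q.proj k (u m)) (HR ⟨u m, hR m⟩)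
        = inner ℂ (Q.proj k (u m)) (HR ⟨Q.proj k (u m), h3⟩) := by
      rw [h4, ← inner_starProjection_left (Q.isStarProjection k),
        starProjection_idem (Q.isStarProjection k)]
    have e4 := D.hermitian_rest ⟨_, h3⟩ ⟨_, h3⟩
    rw [e3]
    apply Complex.conj_eq_iff_im.1
    rw [inner_conj_symm]
    exact e4
  rw [inner_add_right, Complex.add_im, e1, e2, add_zero]

end IsWalkDecomposition

end Walk

/-! ### Unitary evolutions and their generators -/

section Evolution

variable {E : Type*} [NormedAddCommGroup E] [InnerProductSpace ℂ E] [CompleteSpace E]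

namespace IsEvolution

variable {H : E →ₗ.[ℂ] E} {U : ℝ → E →L[ℂ] E} (hU : IsEvolution H U)
include hU

theorem add_apply (s t : ℝ) (x : E) : U (s + t) x = U s (U t x) := by
  rw [hU.add]; rfl

theorem zero_apply (x : E) : U 0 x = x := by
  rw [hU.zero]; rfl

theorem norm_apply (t : ℝ) (x : E) : ‖U t x‖ = ‖x‖ :=
  ContinuousLinearMap.norm_map_of_mem_unitary (hU.unitary t) x

theorem self_apply_neg (t : ℝ) (x : E) : U t (U (-t) x) = x := by
  rw [← hU.add_apply, add_neg_cancel, hU.zero_apply]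

theorem hasDerivAt_zero_iff (x y : E) :
    HasDerivAt (fun t => U t x) (-Complex.I • y) 0 ↔ (x, y) ∈ H.graph := by
  rw [hU.generator]
  constructor
  · rintro ⟨h, e⟩
    rw [smul_right_injective E (neg_ne_zero.2 Complex.I_ne_zero) e]
    exact H.mem_graph ⟨x, h⟩
  · intro h
    exact ⟨H.mem_domain_of_mem_graph h, by rw [apply_eq_of_mem_graph h]⟩

theorem hasDerivAt_apply {x y : E} (h : (x, y) ∈ H.graph) (s : ℝ) :
    HasDerivAt (fun t => U t x) (U s (-Complex.I • y)) s := by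
  have h0 := (hU.hasDerivAt_zero_iff x y).2 h
  have h1 : HasDerivAt (fun t : ℝ => t - s) 1 s := (hasDerivAt_id s).sub_const s
  have h2 : HasDerivAt (fun t => U (t - s) x) (-Complex.I • y) s := by
    have := HasDerivAt.scomp s (h := fun t : ℝ => t - s) (g₁ := fun t => U t x)
      (by simpa using h0) h1
    simpa [Function.comp_def] using this
  have h3 := ((U s).restrictScalars ℝ).hasFDerivAt.comp_hasDerivAt s h2
  refine h3.congr_of_eventuallyEq (Eventually.of_forall fun t => ?_)
  change U t x = U s (U (t - s) x)
  rw [← hU.add_apply, add_sub_cancel]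

/-- The evolution preserves the domain of its generator and commutes with it. -/
theorem mem_graph_apply {x y : E} (h : (x, y) ∈ H.graph) (s : ℝ) : (U s x, U s y) ∈ H.graph := by
  rw [← hU.hasDerivAt_zero_iff]
  have h0 := (hU.hasDerivAt_zero_iff x y).2 h
  have h3 := ((U s).restrictScalars ℝ).hasFDerivAt.comp_hasDerivAt 0 h0
  have e : ((U s).restrictScalars ℝ) (-Complex.I • y) = -Complex.I • U s y :=
    (U s).map_smul _ _
  rw [e] at h3
  refine h3.congr_of_eventuallyEq (Eventually.of_forall fun t => ?_)
  change U t (U s x) = U s (U t x)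
  rw [← hU.add_apply, ← hU.add_apply, add_comm]

/-- Product rule for passing to the interaction picture: differentiability of `f` is only needed
at the point considered, and `f` need not take values in the domain of `H` elsewhere. -/
theorem hasDerivAt_neg_apply {f : ℝ → E} {f' y : E} {s : ℝ} (hf : HasDerivAt f f' s)
    (h : (f s, y) ∈ H.graph) :
    HasDerivAt (fun t => U (-t) (f t)) (U (-s) (f' + Complex.I • y)) s := by
  have hneg : HasDerivAt (fun t : ℝ => -t) (-1) s := hasDerivAt_neg s
  have h1 : HasDerivAt (fun t => U (-t) (f s)) (U (-s) (Complex.I • y)) s := by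
    have := HasDerivAt.scomp s (h := fun t : ℝ => -t) (g₁ := fun t => U t (f s))
      (hU.hasDerivAt_apply h (-s)) hneg
    refine this.congr_deriv ?_
    rw [neg_smul, neg_smul, one_smul, map_neg, neg_neg]
  have h2 : HasDerivAt (fun t => U (-t) (f t - f s)) (U (-s) f') s := by
    rw [hasDerivAt_iff_isLittleO] at hf ⊢
    have e : ∀ t, U (-t) (f t - f s) - U (-s) (f s - f s) - (t - s) • U (-s) f'
        = U (-t) (f t - f s - (t - s) • f') + (t - s) • (U (-t) f' - U (-s) f') := by
      intro t
      have : U (-t) ((t - s) • f') = (t - s) • U (-t) f' :=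
        ((U (-t)).restrictScalars ℝ).map_smul _ _
      simp only [map_sub, sub_self, map_zero, sub_zero, this, smul_sub]
      abel
    refine Asymptotics.IsLittleO.congr_left (Asymptotics.IsLittleO.add ?_ ?_) fun t => (e t).symm
    · refine Asymptotics.IsLittleO.of_norm_left ?_
      simp_rw [hU.norm_apply]
      exact hf.norm_left
    · have hc : Tendsto (fun t => U (-t) f' - U (-s) f') (𝓝 s) (𝓝 0) := by
        have : Continuous fun t => U (-t) f' - U (-s) f' :=
          ((hU.continuous f').comp continuous_neg).sub continuous_const
        simpa using this.tendsto s
      have := (Asymptotics.isBigO_refl (fun t : ℝ => t - s) (𝓝 s)).smul_isLittleO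
        ((Asymptotics.isLittleO_one_iff ℝ).2 hc)
      simpa using this
  have := h2.add h1
  rw [← map_add] at this
  refine this.congr_of_eventuallyEq (Eventually.of_forall fun t => ?_)
  simp

/-- A bounded operator that commutes with an everywhere defined generator is conserved. -/
theorem commute_of_commute {a b : E →L[ℂ] E} (hb : ∀ x, (x, b x) ∈ H.graph) (hab : Commute a b)
    (t : ℝ) (x : E) : a (U t x) = U t (a x) := by
  have key : ∀ s, HasDerivAt (fun t => U (-t) (a (U t x))) 0 s := fun s => by
    have h1 := hU.hasDerivAt_apply (hb x) s
    have h2 := (a.restrictScalars ℝ).hasFDerivAt.comp_hasDerivAt s h1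
    have h3 := hU.hasDerivAt_neg_apply h2 (hb (a (U s x)))
    refine h3.congr_deriv ?_
    have e : U s (b x) = b (U s x) :=
      H.mem_graph_snd_inj (hU.mem_graph_apply (hb x) s) (hb _) rfl
    have e2 := commute_apply hab (U s x)
    change U (-s) (a (U s (-Complex.I • b x)) + _) = 0
    rw [map_smul, map_smul, e, e2, neg_smul, neg_add_cancel, map_zero]
  have h := is_const_of_deriv_eq_zero (fun s => (key s).differentiableAt)
    (fun s => (key s).deriv) t 0
  simp only [neg_zero, hU.zero_apply] at h
  rw [← h, hU.self_apply_neg]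

end IsEvolution

end Evolution

/-! ### Exponential weights -/

section Weights

/-- The exponential weight `exp (a (|k| + 1) ^ (1 - r))` on quantum numbers. -/
noncomputable def weight (a r : ℝ) (k : ℤ) : ℝ := Real.exp (a * (|(k : ℝ)| + 1) ^ (1 - r))

/-- Discrete form of `d/dm (m + 1) ^ (1 - r) = (1 - r) (m + 1) ^ (-r)`. The shift by one in the
weight keeps the factor `1 - r` also at `m = 0`. -/
theorem rpow_succ_sub_rpow_mul_le {r m : ℝ} (hr0 : 0 ≤ r) (hr : r < 1) (hm : 0 ≤ m) :
    ((m + 1 + 1) ^ (1 - r) - (m + 1) ^ (1 - r)) * (m + 1) ^ r ≤ 1 - r := by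
  have hm1 : 0 < m + 1 := by linarith
  have h := rpow_one_add_le_one_add_mul_self (s := 1 / (m + 1)) (by
    have : 0 ≤ 1 / (m + 1) := by positivity
    linarith) (p := 1 - r) (by linarith) (by linarith)
  have e : m + 1 + 1 = (m + 1) * (1 + 1 / (m + 1)) := by field_simp
  have e2 : (m + 1) ^ (1 - r) * (m + 1) ^ r = m + 1 := by
    rw [← Real.rpow_add hm1]; simp
  have hinv : 0 ≤ 1 / (m + 1) := by positivity
  calc ((m + 1 + 1) ^ (1 - r) - (m + 1) ^ (1 - r)) * (m + 1) ^ r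
      = ((1 + 1 / (m + 1)) ^ (1 - r) - 1) * ((m + 1) ^ (1 - r) * (m + 1) ^ r) := by
        rw [e, Real.mul_rpow hm1.le (by linarith)]; ring
    _ ≤ ((1 - r) * (1 / (m + 1))) * (m + 1) := by
        rw [e2]
        gcongr
        linarith
    _ = 1 - r := by field_simp

theorem exp_sub_exp_neg_le {d : ℝ} (h0 : 0 ≤ d) (h1 : d ≤ 1) :
    Real.exp d - Real.exp (-d) ≤ 3 * d := by
  have h := abs_le.1 (Real.abs_exp_sub_one_sub_id_le (x := d) (by rwa [abs_of_nonneg h0]))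
  have h' := Real.add_one_le_exp (-d)
  nlinarith

/-- The growth of the weight compensates the growth of the walk term: this is where the exponent
`1 - r` comes from. -/
theorem abs_weight_sq_sub_mul_le {a r : ℝ} (ha0 : 0 ≤ a) (ha : a ≤ 1) (hr0 : 0 ≤ r) (hr : r < 1)
    {k l : ℤ} (hkl : |k - l| = 1) (h : |k| ≤ |l|) :
    |weight a r k ^ 2 - weight a r l ^ 2| * (|(k : ℝ)| + 1) ^ r ≤
      3 * (a * (1 - r)) * (weight a r k * weight a r l) := by
  have hl : |l| = |k| + 1 := by
    rcases abs_cases k with ⟨h1, _⟩ | ⟨h1, _⟩ <;> rcases abs_cases l with ⟨h2, _⟩ | ⟨h2, _⟩ <;>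
    rcases abs_cases (k - l) with ⟨h3, _⟩ | ⟨h3, _⟩ <;> lia
  have hl' : |(l : ℝ)| = |(k : ℝ)| + 1 := by exact_mod_cast hl
  have hm : 0 ≤ |(k : ℝ)| := abs_nonneg _
  unfold weight
  rw [hl']
  generalize |(k : ℝ)| = m at hm
  set f := a * (m + 1) ^ (1 - r) with hf
  set f' := a * (m + 1 + 1) ^ (1 - r) with hf'
  have h1r : 0 ≤ 1 - r := by linarith
  have hd0 : 0 ≤ f' - f := by
    rw [hf, hf', ← mul_sub]
    refine mul_nonneg ha0 (sub_nonneg.2 ?_)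
    gcongr
    linarith
  have hdr : (f' - f) * (m + 1) ^ r ≤ a * (1 - r) := by
    rw [hf, hf', ← mul_sub, mul_assoc]
    gcongr
    exact rpow_succ_sub_rpow_mul_le hr0 hr hm
  have hone : 1 ≤ (m + 1) ^ r := Real.one_le_rpow (by linarith) hr0
  have hd1 : f' - f ≤ 1 := by nlinarith
  have hle : Real.exp f ^ 2 ≤ Real.exp f' ^ 2 := by
    have : Real.exp f ≤ Real.exp f' := Real.exp_le_exp.2 (by linarith)
    gcongr
  have e : Real.exp f' ^ 2 - Real.exp f ^ 2
      = (Real.exp (f' - f) - Real.exp (-(f' - f))) * (Real.exp f * Real.exp f') := by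
    simp only [sq, sub_mul, ← Real.exp_add]
    ring_nf
  rw [abs_sub_comm, abs_of_nonneg (by linarith), e]
  have h3 := exp_sub_exp_neg_le hd0 hd1
  calc (Real.exp (f' - f) - Real.exp (-(f' - f))) * (Real.exp f * Real.exp f') * (m + 1) ^ r
      ≤ (3 * (f' - f)) * (Real.exp f * Real.exp f') * (m + 1) ^ r := by gcongr
    _ = 3 * ((f' - f) * (m + 1) ^ r) * (Real.exp f * Real.exp f') := by ring
    _ ≤ _ := by gcongr

end Weights

/-! ### Currents between quantum numbers -/

section Current

variable {E : Type*} [NormedAddCommGroup E] [InnerProductSpace ℂ E] [CompleteSpace E]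

namespace IsWalkDecomposition

variable {Q : QuantumNumber E} {χ r : ℝ} {H HW HR : E →ₗ.[ℂ] E}
  (D : IsWalkDecomposition Q χ r H HW HR)
include D

/-- The current from the quantum number `k` to the quantum number `l` in the state `x`, up to a
factor: the imaginary part of `⟨H_W Π_k x, Π_l x⟩`. -/
noncomputable def current (x : E) (k l : ℤ) : ℝ :=
  (inner ℂ (D.walkProj k x) (Q.proj l x)).im

theorem current_swap (x : E) (k l : ℤ) : D.current x l k = -D.current x k l := by
  rw [current, current, D.inner_walkProj_proj, ← inner_conj_symm, Complex.conj_im]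

theorem abs_current_le (x : E) (k l : ℤ) :
    |D.current x k l| ≤ χ * (|(k : ℝ)| + 1) ^ r * (‖Q.proj k x‖ * ‖Q.proj l x‖) :=
  calc |D.current x k l| ≤ ‖D.walkProj k x‖ * ‖Q.proj l x‖ :=
        (Complex.abs_im_le_norm _).trans (norm_inner_le_norm _ _)
    _ ≤ (χ * (|(k : ℝ)| + 1) ^ r * ‖Q.proj k x‖) * ‖Q.proj l x‖ := by
        gcongr
        exact D.norm_walkProj_le k x
    _ = _ := by ring

theorem current_eq_zero (x : E) {k l : ℤ} (h : 1 < |k - l|) : D.current x k l = 0 := by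
  rw [current, ← starProjection_idem (Q.isStarProjection l),
    ← inner_starProjection_left (Q.isStarProjection l),
    D.proj_walkProj_eq_zero (by rwa [abs_sub_comm]), inner_zero_left, Complex.zero_im]

theorem abs_weighted_current_le (hχ : 0 ≤ χ) (hr0 : 0 ≤ r) (hr : r < 1) {a : ℝ} (ha0 : 0 ≤ a)
    (ha : a ≤ 1) (x : E) (k l : ℤ) :
    |(weight a r k ^ 2 - weight a r l ^ 2) * D.current x k l| ≤
      if |k - l| = 1 then 3 * (a * (1 - r)) * χ / 2 *
        (weight a r k ^ 2 * ‖Q.proj k x‖ ^ 2 + weight a r l ^ 2 * ‖Q.proj l x‖ ^ 2) else 0 := by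
  split_ifs with h
  · wlog hkl : |k| ≤ |l| generalizing k l with hw
    · have := hw l k (by rwa [abs_sub_comm]) (le_of_not_ge hkl)
      rw [D.current_swap, mul_neg, ← neg_mul, neg_sub] at this
      rwa [add_comm (weight a r k ^ 2 * _)]
    · have h1 := abs_weight_sq_sub_mul_le ha0 ha hr0 hr h hkl
      have h2 := D.abs_current_le x k l
      have hC : 0 ≤ 3 * (a * (1 - r)) * χ / 2 := by
        have : 0 ≤ 1 - r := by linarith
        positivity
      have h3 := two_mul_le_add_sq (weight a r k * ‖Q.proj k x‖) (weight a r l * ‖Q.proj l x‖)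
      rw [abs_mul]
      calc |weight a r k ^ 2 - weight a r l ^ 2| * |D.current x k l|
          ≤ |weight a r k ^ 2 - weight a r l ^ 2| *
            (χ * (|(k : ℝ)| + 1) ^ r * (‖Q.proj k x‖ * ‖Q.proj l x‖)) := by gcongr
        _ = (|weight a r k ^ 2 - weight a r l ^ 2| * (|(k : ℝ)| + 1) ^ r) *
            (χ * (‖Q.proj k x‖ * ‖Q.proj l x‖)) := by ring
        _ ≤ (3 * (a * (1 - r)) * (weight a r k * weight a r l)) *
            (χ * (‖Q.proj k x‖ * ‖Q.proj l x‖)) := by gcongr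
        _ = 3 * (a * (1 - r)) * χ / 2 *
            (2 * (weight a r k * ‖Q.proj k x‖) * (weight a r l * ‖Q.proj l x‖)) := by ring
        _ ≤ 3 * (a * (1 - r)) * χ / 2 *
            ((weight a r k * ‖Q.proj k x‖) ^ 2 + (weight a r l * ‖Q.proj l x‖) ^ 2) := by gcongr
        _ = _ := by ring
  · refine le_of_eq ?_
    rcases eq_or_ne k l with rfl | hne
    · simp
    · rw [D.current_eq_zero x, mul_zero, abs_zero]
      have : 0 < |k - l| := abs_pos.2 (sub_ne_zero.2 hne)
      lia

omit D in
theorem card_filter_abs_sub_eq_one_le (S : Finset ℤ) (k : ℤ) :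
    (S.filter fun l => |k - l| = 1).card ≤ 2 := by
  refine (Finset.card_le_card (t := {k - 1, k + 1}) fun l hl => ?_).trans Finset.card_le_two
  have := (Finset.mem_filter.1 hl).2
  rw [Finset.mem_insert, Finset.mem_singleton]
  rcases abs_cases (k - l) with ⟨h3, _⟩ | ⟨h3, _⟩ <;> lia

/-- The rate of change of the weighted norm is bounded by the weighted norm. By antisymmetry of the
current only the differences of the weights at neighbouring quantum numbers enter. -/
theorem abs_sum_weight_mul_im_inner_le (hχ : 0 ≤ χ) (hr0 : 0 ≤ r) (hr : r < 1) {a : ℝ}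
    (ha0 : 0 ≤ a) (ha : a ≤ 1) {z : ℤ} {x : E} (hx : Q.intWindow z x = x) :
    |∑ k ∈ Finset.Icc (-z) z, weight a r k ^ 2 * (2 * (inner ℂ (D.walkProj k x) x).im)| ≤
      6 * (a * (1 - r)) * χ * ∑ k ∈ Finset.Icc (-z) z, weight a r k ^ 2 * ‖Q.proj k x‖ ^ 2 := by
  set S := Finset.Icc (-z) z with hS
  set w := fun k => weight a r k ^ 2 with hw
  set y := fun k => weight a r k ^ 2 * ‖Q.proj k x‖ ^ 2 with hy
  have h1 : ∀ k, (inner ℂ (D.walkProj k x) x).im = ∑ l ∈ S, D.current x k l := fun k => by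
    conv_lhs => rw [← hx, Q.intWindow_apply, inner_sum, Complex.im_sum]
    refine Finset.sum_congr rfl fun l _ => ?_
    rw [current, ← Q.intWindow_apply, hx]
  have h2 : ∑ k ∈ S, w k * (2 * (inner ℂ (D.walkProj k x) x).im)
      = ∑ k ∈ S, ∑ l ∈ S, (w k - w l) * D.current x k l := by
    have hswap : ∑ k ∈ S, ∑ l ∈ S, w l * D.current x k l
        = -∑ k ∈ S, ∑ l ∈ S, w k * D.current x k l := by
      rw [Finset.sum_comm, ← Finset.sum_neg_distrib]
      refine Finset.sum_congr rfl fun k _ => ?_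
      rw [← Finset.sum_neg_distrib]
      refine Finset.sum_congr rfl fun l _ => ?_
      rw [D.current_swap, mul_neg]
    simp_rw [sub_mul, Finset.sum_sub_distrib]
    rw [hswap, sub_neg_eq_add, ← two_mul, Finset.mul_sum]
    refine Finset.sum_congr rfl fun k _ => ?_
    rw [h1, ← Finset.mul_sum]
    ring
  have hK : 0 ≤ 3 * (a * (1 - r)) * χ / 2 := by
    have : 0 ≤ 1 - r := by linarith
    positivity
  have hy0 : ∀ k, 0 ≤ y k := fun k => by positivity
  have hrow : ∀ k, ∑ l ∈ S, (if |k - l| = 1 then y k else 0) ≤ 2 * y k := fun k => by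
    rw [← Finset.sum_filter, Finset.sum_const, nsmul_eq_mul]
    have : ((S.filter fun l => |k - l| = 1).card : ℝ) ≤ 2 := by
      exact_mod_cast card_filter_abs_sub_eq_one_le S k
    exact mul_le_mul_of_nonneg_right this (hy0 k)
  have hsum1 : ∑ k ∈ S, ∑ l ∈ S, (if |k - l| = 1 then y k else 0) ≤ 2 * ∑ k ∈ S, y k := by
    rw [Finset.mul_sum]
    exact Finset.sum_le_sum fun k _ => hrow k
  have hsum2 : ∑ k ∈ S, ∑ l ∈ S, (if |k - l| = 1 then y l else 0) ≤ 2 * ∑ k ∈ S, y k := by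
    rw [Finset.sum_comm]
    refine le_trans (le_of_eq ?_) hsum1
    refine Finset.sum_congr rfl fun k _ => Finset.sum_congr rfl fun l _ => ?_
    rw [abs_sub_comm]
  rw [h2]
  calc |∑ k ∈ S, ∑ l ∈ S, (w k - w l) * D.current x k l|
      ≤ ∑ k ∈ S, ∑ l ∈ S, |(w k - w l) * D.current x k l| :=
        (Finset.abs_sum_le_sum_abs _ _).trans
          (Finset.sum_le_sum fun k _ => Finset.abs_sum_le_sum_abs _ _)
    _ ≤ ∑ k ∈ S, ∑ l ∈ S, (if |k - l| = 1 then 3 * (a * (1 - r)) * χ / 2 * (y k + y l) else 0) :=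
        Finset.sum_le_sum fun k _ => Finset.sum_le_sum fun l _ =>
          D.abs_weighted_current_le hχ hr0 hr ha0 ha x k l
    _ = 3 * (a * (1 - r)) * χ / 2 * (∑ k ∈ S, ∑ l ∈ S, (if |k - l| = 1 then y k else 0) +
          ∑ k ∈ S, ∑ l ∈ S, (if |k - l| = 1 then y l else 0)) := by
        rw [← Finset.sum_add_distrib, Finset.mul_sum]
        refine Finset.sum_congr rfl fun k _ => ?_
        rw [← Finset.sum_add_distrib, Finset.mul_sum]
        refine Finset.sum_congr rfl fun l _ => ?_
        split_ifs <;> simp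
    _ ≤ 3 * (a * (1 - r)) * χ / 2 * (2 * ∑ k ∈ S, y k + 2 * ∑ k ∈ S, y k) := by gcongr
    _ = _ := by ring

end IsWalkDecomposition

end Current

/-! ### A Grönwall inequality -/

section Gronwall

/-- Two-sided Grönwall inequality. -/
theorem le_exp_mul_of_abs_deriv_le {M M' : ℝ → ℝ} {L : ℝ} (hM : ∀ s, HasDerivAt M (M' s) s)
    (hL : ∀ s, |M' s| ≤ L * M s) (t : ℝ) : M t ≤ Real.exp (L * |t|) * M 0 := by
  have hderiv : ∀ c s, HasDerivAt (fun u => M u * Real.exp (c * u))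
      ((M' s + c * M s) * Real.exp (c * s)) s := fun c s => by
    have h1 : HasDerivAt (fun u => c * u) c s := by
      simpa using (hasDerivAt_id s).const_mul c
    refine ((hM s).mul h1.exp).congr_deriv ?_
    ring
  rcases le_total 0 t with ht | ht
  · have hanti : Antitone fun u => M u * Real.exp (-L * u) := by
      refine antitone_of_deriv_nonpos (fun s => (hderiv _ s).differentiableAt) fun s => ?_
      rw [(hderiv _ s).deriv]
      have := (abs_le.1 (hL s)).2
      exact mul_nonpos_of_nonpos_of_nonneg (by linarith) (Real.exp_pos _).le
    have h := hanti ht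
    simp only [mul_zero, Real.exp_zero, mul_one] at h
    rw [abs_of_nonneg ht]
    calc M t = Real.exp (L * t) * (M t * Real.exp (-L * t)) := by
          rw [mul_left_comm, ← Real.exp_add]; simp
      _ ≤ _ := by gcongr
  · have hmono : Monotone fun u => M u * Real.exp (L * u) := by
      refine monotone_of_deriv_nonneg (fun s => (hderiv _ s).differentiableAt) fun s => ?_
      rw [(hderiv _ s).deriv]
      have := (abs_le.1 (hL s)).1
      exact mul_nonneg (by linarith) (Real.exp_pos _).le
    have h := hmono ht
    simp only [mul_zero, Real.exp_zero, mul_one] at h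
    rw [abs_of_nonpos ht]
    calc M t = Real.exp (L * -t) * (M t * Real.exp (L * t)) := by
          rw [mul_left_comm, ← Real.exp_add]; simp
      _ ≤ _ := by gcongr

end Gronwall

/-! ### Truncated operators and their commutator -/

section Compression

variable {E : Type*} [NormedAddCommGroup E] [InnerProductSpace ℂ E] [CompleteSpace E]

/-- The operator `H P`, for a self-adjoint operator `H` whose domain contains the range of `P`. It
is bounded by the closed graph theorem. -/
noncomputable def mulRight {H : E →ₗ.[ℂ] E} (hH : IsSelfAdjoint H) (P : E →L[ℂ] E)
    (hP : ∀ x, P x ∈ H.domain) : E →L[ℂ] E :=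
  ContinuousLinearMap.ofIsClosedGraph
    (g := H.toFun ∘ₗ (P : E →ₗ[ℂ] E).codRestrict H.domain hP) <| by
      have hcl : IsClosed (H.graph : Set (E × E)) := hH.isClosed
      convert hcl.preimage (f := fun p : E × E => (P p.1, p.2)) (by fun_prop)
      ext ⟨x, y⟩
      constructor
      · intro h
        have h : y = H ⟨P x, hP x⟩ := (LinearMap.mem_graph_iff _ _).1 h
        change (P x, y) ∈ H.graph
        rw [h]
        exact H.mem_graph ⟨P x, hP x⟩
      · intro h
        refine (LinearMap.mem_graph_iff _ _).2 ?_
        exact (apply_eq_of_mem_graph h (hP x)).symm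

variable {H : E →ₗ.[ℂ] E} (hH : IsSelfAdjoint H) {P : E →L[ℂ] E} (hP : ∀ x, P x ∈ H.domain)

theorem mulRight_mem_graph (x : E) : (P x, mulRight hH P hP x) ∈ H.graph :=
  H.mem_graph ⟨P x, hP x⟩

theorem mulRight_mem_graph_of_eq {x : E} (hx : P x = x) : (x, mulRight hH P hP x) ∈ H.graph := by
  have h := mulRight_mem_graph hH hP x
  rwa [hx] at h

theorem mulRight_eq_of_mem_graph {x y : E} (hx : P x = x) (h : (x, y) ∈ H.graph) :
    mulRight hH P hP x = y :=
  H.mem_graph_snd_inj (mulRight_mem_graph_of_eq hH hP hx) h rfl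

/-- The bounded operator `P H P`. -/
noncomputable def compression : E →L[ℂ] E := P * mulRight hH P hP

include hP in
omit [CompleteSpace E] in
theorem truncated_domain : (truncated P H).domain = ⊤ := by
  rw [Submodule.eq_top_iff']
  intro x
  exact mem_pcomp_domain.2 ⟨mem_pcomp_domain.2 ⟨trivial, hP x⟩, trivial⟩

theorem compression_mem_graph (x : E) : (x, compression hH hP x) ∈ (truncated P H).graph := by
  have hx : x ∈ (truncated P H).domain := truncated_domain hP ▸ Submodule.mem_top
  exact (truncated P H).mem_graph ⟨x, hx⟩

theorem mulRight_comp_self (hp : IsStarProjection P) (x : E) :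
    mulRight hH P hP (P x) = mulRight hH P hP x := by
  refine mulRight_eq_of_mem_graph hH hP (starProjection_idem hp x) ?_
  exact mulRight_mem_graph hH hP x

theorem commute_compression (hp : IsStarProjection P) : Commute P (compression hH hP) := by
  ext x
  change P (P (mulRight hH P hP x)) = P (mulRight hH P hP (P x))
  rw [starProjection_idem hp, mulRight_comp_self hH hP hp]

include hH hP in
theorem IsEvolution.proj_apply_eq_self {V : ℝ → E →L[ℂ] E} (hV : IsEvolution (truncated P H) V)
    (hp : IsStarProjection P) {x : E} (hx : P x = x) (t : ℝ) : P (V t x) = V t x := by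
  have := hV.commute_of_commute (compression_mem_graph hH hP) (commute_compression hH hP hp) t x
  rwa [hx] at this

theorem IsEvolution.hasDerivAt_compression {V : ℝ → E →L[ℂ] E}
    (hV : IsEvolution (truncated P H) V) (x : E) (s : ℝ) :
    HasDerivAt (fun t => V t x) (-Complex.I • compression hH hP (V s x)) s := by
  have h := hV.hasDerivAt_apply (compression_mem_graph hH hP x) s
  have e := (truncated P H).mem_graph_snd_inj
    (hV.mem_graph_apply (compression_mem_graph hH hP x) s) (compression_mem_graph hH hP (V s x)) rfl
  rwa [map_smul, e] at h

omit [CompleteSpace E] in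
theorem enorm_apply_le_pnorm (A : E →ₗ.[ℂ] E) (x : A.domain) :
    ‖A x‖ₑ ≤ pnorm A * ‖(x : E)‖ₑ := by
  rcases eq_or_ne (x : E) 0 with h0 | h0
  · have : x = 0 := Subtype.ext h0
    simp [this]
  · have hn : ‖(x : E)‖ ≠ 0 := norm_ne_zero_iff.2 h0
    have h1 : ‖A (((‖(x : E)‖ : ℂ)⁻¹) • x)‖ₑ ≤ pnorm A := by
      refine le_iSup₂_of_le (f := fun (ψ : A.domain) (_ : ‖(ψ : E)‖ ≤ 1) => ‖A ψ‖ₑ)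
        (((‖(x : E)‖ : ℂ)⁻¹) • x) ?_ le_rfl
      simp [norm_smul, hn]
    have h2 : A x = (‖(x : E)‖ : ℂ) • A (((‖(x : E)‖ : ℂ)⁻¹) • x) := by
      rw [A.map_smul, smul_smul, mul_inv_cancel₀ (by exact_mod_cast hn), one_smul]
    rw [h2, enorm_smul, mul_comm]
    gcongr
    simp [enorm]

/-- The commutator `[H, P H P]` on the range of `P`, as the bounded operator `[H, P H P] P` on the
whole space. -/
noncomputable def commutatorOn : E →L[ℂ] E :=
  (mulRight hH P hP * compression hH hP - compression hH hP * mulRight hH P hP) * P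

theorem commutatorOn_apply {x : E} (hx : P x = x) : commutatorOn hH hP x =
    mulRight hH P hP (compression hH hP x) - compression hH hP (mulRight hH P hP x) := by
  change mulRight hH P hP (compression hH hP (P x)) - compression hH hP (mulRight hH P hP (P x)) = _
  rw [hx]

/-- The bounded commutator on the range of `P` is a restriction of the commutator on its natural
domain. -/
theorem enorm_commutatorOn_le (hp : IsStarProjection P) :
    ‖commutatorOn hH hP‖ₑ ≤ pnorm (pcomm H (truncated P H)) := by
  set A := pnorm (pcomm H (truncated P H)) with hA
  rcases eq_or_ne A ⊤ with htop | htop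
  · rw [htop]; exact le_top
  have hval : ∀ x, P x = x → ‖commutatorOn hH hP x‖ₑ ≤ A * ‖x‖ₑ := by
    intro x hx
    have hT : ∀ y, y ∈ (truncated P H).domain := fun y =>
      truncated_domain hP ▸ Submodule.mem_top
    have hxH : x ∈ H.domain := hx ▸ hP x
    have hb : P (compression hH hP x) = compression hH hP x := starProjection_idem hp _
    have hTx : truncated P H ⟨x, hT x⟩ = compression hH hP x := rfl
    have hd1 : x ∈ (pcomp H (truncated P H)).domain :=
      mem_pcomp_domain.2 ⟨hT x, by rw [hTx, ← hb]; exact hP _⟩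
    have hd2 : x ∈ (pcomp (truncated P H) H).domain := mem_pcomp_domain.2 ⟨hxH, hT _⟩
    have e1 : pcomp H (truncated P H) ⟨x, hd1⟩ = mulRight hH P hP (compression hH hP x) := by
      rw [pcomp_apply hd1 (hT x) (by rw [hTx, ← hb]; exact hP _)]
      exact apply_eq_of_mem_graph (mulRight_mem_graph_of_eq hH hP hb) _
    have e2 : pcomp (truncated P H) H ⟨x, hd2⟩ = compression hH hP (mulRight hH P hP x) := by
      rw [pcomp_apply hd2 hxH (hT _)]
      have : H ⟨x, hxH⟩ = mulRight hH P hP x :=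
        apply_eq_of_mem_graph (mulRight_mem_graph_of_eq hH hP hx) hxH
      rw [← this]
      rfl
    have h := enorm_apply_le_pnorm (pcomm H (truncated P H)) ⟨x, hd1, hd2⟩
    rw [commutatorOn_apply hH hP hx, ← e1, ← e2]
    exact h
  have hreal : ‖commutatorOn hH hP‖ ≤ A.toReal := by
    refine ContinuousLinearMap.opNorm_le_bound _ ENNReal.toReal_nonneg fun x => ?_
    have h := hval (P x) (starProjection_idem hp x)
    have e : commutatorOn hH hP (P x) = commutatorOn hH hP x := by
      change (mulRight hH P hP * compression hH hP - compression hH hP * mulRight hH P hP)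
        (P (P x)) = _
      rw [starProjection_idem hp]; rfl
    rw [e] at h
    have h' := ENNReal.toReal_mono (ENNReal.mul_ne_top htop enorm_ne_top) h
    rw [ENNReal.toReal_mul, toReal_enorm, toReal_enorm] at h'
    refine h'.trans ?_
    gcongr
    exact norm_starProjection_apply_le hp x
  rw [← ofReal_norm, ← ENNReal.ofReal_toReal htop]
  exact ENNReal.ofReal_le_ofReal hreal

end Compression

/-! ### Leakage and the truncation error -/

section Leakage

variable {E : Type*} [NormedAddCommGroup E] [InnerProductSpace ℂ E] [CompleteSpace E]

omit [CompleteSpace E] in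
theorem hasDerivAt_norm_sq {f : ℝ → E} {f' : E} {s : ℝ} (hf : HasDerivAt f f' s) :
    HasDerivAt (fun t => ‖f t‖ ^ 2) (2 * (inner ℂ (f s) f').re) s := by
  have h := Complex.reCLM.hasFDerivAt.comp_hasDerivAt s (hf.inner ℂ hf)
  have e : ∀ x : E, (inner ℂ x x).re = ‖x‖ ^ 2 := fun x => by
    rw [← inner_self_eq_norm_sq (𝕜 := ℂ)]; rfl
  refine (h.congr_deriv ?_).congr_of_eventuallyEq (Eventually.of_forall fun t => ?_)
  · change (inner ℂ (f s) f' + inner ℂ f' (f s)).re = _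
    rw [Complex.add_re, ← inner_conj_symm f' (f s), Complex.conj_re]
    ring
  · exact (e (f t)).symm

variable {n : ℕ} {Q : Fin n → QuantumNumber E} {χ r : ℝ} {H : E →ₗ.[ℂ] E}

namespace IsModel

variable (hM : IsModel Q χ r H)
include hM

theorem isStarProjection_windowAll (Λ : ℕ) : IsStarProjection (windowAll Q Λ) :=
  isStarProjection_intWindowAll hM.commute Λ

/-- A single application of `H` enlarges the window of quantum numbers by at most one. -/
theorem intWindowAll_succ_of_mem_graph {z : ℤ} {x y : E} (hx : intWindowAll Q z x = x)
    (h : (x, y) ∈ H.graph) : intWindowAll Q (z + 1) y = y := by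
  rw [intWindowAll_eq_self_iff hM.commute] at hx ⊢
  intro ν k hk
  obtain ⟨HW, HR, D⟩ := hM.decomposition ν
  exact D.proj_eq_zero_of_mem_graph hM.selfAdjoint h (hx ν) hk

variable {Λ : ℕ} (hdom : ∀ x, windowAll Q Λ x ∈ H.domain)

/-- The truncation is invisible to a vector supported one step inside the window. -/
theorem mulRight_eq_compression {z : ℤ} (hz : z + 1 ≤ Λ) {x : E} (hx : intWindowAll Q z x = x) :
    mulRight hM.selfAdjoint (windowAll Q Λ) hdom x =
      compression hM.selfAdjoint hdom x := by
  have hP : windowAll Q Λ x = x := intWindowAll_mono hM.commute (by lia) hx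
  have h := mulRight_mem_graph_of_eq hM.selfAdjoint hdom hP
  exact (intWindowAll_mono hM.commute hz (hM.intWindowAll_succ_of_mem_graph hx h)).symm

/-- The commutator `[H, H̃]` vanishes on vectors supported two steps inside the window. -/
theorem commutatorOn_eq_zero {z : ℤ} (hz : z + 2 ≤ Λ) {x : E} (hx : intWindowAll Q z x = x) :
    commutatorOn hM.selfAdjoint hdom x = 0 := by
  have hP : windowAll Q Λ x = x := intWindowAll_mono hM.commute (by lia) hx
  have h := mulRight_mem_graph_of_eq hM.selfAdjoint hdom hP
  rw [commutatorOn_apply _ _ hP, ← hM.mulRight_eq_compression hdom (by lia) hx,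
    hM.mulRight_eq_compression hdom (z := z + 1) (by lia)
      (hM.intWindowAll_succ_of_mem_graph hx h), sub_self]

variable {V : ℝ → E →L[ℂ] E} (hV : IsEvolution (truncatedHamiltonian Q H Λ) V)
include hdom hV

theorem windowAll_apply_eq_self {x : E} (hx : windowAll Q Λ x = x) (s : ℝ) :
    windowAll Q Λ (V s x) = V s x :=
  IsEvolution.proj_apply_eq_self hM.selfAdjoint hdom hV (hM.isStarProjection_windowAll Λ) hx s

/-- Leakage bound: under the truncated evolution, states with quantum numbers in `[-Λ₀, Λ₀]` have
exponentially small weight on the two outermost layers of the window. -/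
theorem norm_sub_intWindow_le (hχ : 0 ≤ χ) (hr0 : 0 ≤ r) (hr : r < 1) {a : ℝ} (ha0 : 0 ≤ a)
    (ha : a ≤ 1) {Λ₀ : ℕ} (hΛ : Λ₀ ≤ Λ) {x : E} (hx : windowAll Q Λ₀ x = x) (ν : Fin n) (s : ℝ) :
    ‖V s x - (Q ν).intWindow (Λ - 2) (V s x)‖ ≤
      Real.exp (3 * (a * (1 - r)) * χ * |s| +
        (a * ((Λ₀ : ℝ) + 1) ^ (1 - r) - a * (Λ : ℝ) ^ (1 - r))) * ‖x‖ := by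
  obtain ⟨HW, HR, D⟩ := hM.decomposition ν
  have hc := hM.commute
  have h1r : 0 ≤ 1 - r := by linarith
  have hp := hM.isStarProjection_windowAll Λ
  have hxΛ : windowAll Q Λ x = x := intWindowAll_mono hc (by exact_mod_cast hΛ) hx
  have hφ : ∀ s, windowAll Q Λ (V s x) = V s x := hM.windowAll_apply_eq_self hdom hV hxΛ
  have hcP : ∀ k, Commute ((Q ν).proj k) (windowAll Q Λ) := fun k =>
    commute_proj_intWindowAll hc ν k Λ
  have hφν : ∀ s, (Q ν).intWindow Λ (V s x) = V s x := fun s =>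
    ((Q ν).intWindow_eq_self_iff _ _).2 ((intWindowAll_eq_self_iff hc Λ _).1 (hφ s) ν)
  set S := Finset.Icc (-(Λ : ℤ)) Λ with hS
  set M : ℝ → ℝ := fun s => ∑ k ∈ S, weight a r k ^ 2 * ‖(Q ν).proj k (V s x)‖ ^ 2 with hMdef
  have hderiv : ∀ s, HasDerivAt M (∑ k ∈ S, weight a r k ^ 2 *
      (2 * (inner ℂ (D.walkProj k (V s x)) (V s x)).im)) s := by
    intro s
    refine HasDerivAt.fun_sum fun k _ => HasDerivAt.const_mul _ ?_
    have h1 := (((Q ν).proj k).restrictScalars ℝ).hasFDerivAt.comp_hasDerivAt s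
      (hV.hasDerivAt_compression hM.selfAdjoint hdom x s)
    refine (hasDerivAt_norm_sq h1).congr_deriv ?_
    change 2 * (inner ℂ ((Q ν).proj k (V s x)) ((Q ν).proj k (-Complex.I •
      windowAll Q Λ (mulRight hM.selfAdjoint (windowAll Q Λ) hdom (V s x))))).re = _
    rw [← inner_starProjection_left ((Q ν).isStarProjection k),
      starProjection_idem ((Q ν).isStarProjection k), inner_smul_right,
      ← inner_starProjection_left hp,
      ← commute_apply (hcP k), hφ,
      ← D.im_inner_proj_of_mem_graph k
        (mulRight_mem_graph_of_eq hM.selfAdjoint hdom (hφ s))]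
    simp
  have hgron := le_exp_mul_of_abs_deriv_le hderiv
    (fun s => D.abs_sum_weight_mul_im_inner_le hχ hr0 hr ha0 ha (hφν s)) s
  have hM0 : M 0 ≤ Real.exp (a * ((Λ₀ : ℝ) + 1) ^ (1 - r)) ^ 2 * ‖x‖ ^ 2 := by
    have h0 := hφν 0
    rw [hV.zero_apply] at h0
    have h1 : ‖x‖ ^ 2 = ∑ k ∈ S, ‖(Q ν).proj k x‖ ^ 2 := by
      rw [← (Q ν).norm_sq_intWindow, h0]
    simp only [hMdef, hV.zero_apply]
    rw [h1, Finset.mul_sum]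
    refine Finset.sum_le_sum fun k _ => ?_
    by_cases hk : (Λ₀ : ℤ) < |k|
    · rw [(intWindowAll_eq_self_iff hc Λ₀ x).1 hx ν k hk]; simp
    · have hk' : |(k : ℝ)| ≤ Λ₀ := by exact_mod_cast not_lt.1 hk
      unfold weight
      gcongr
  set y := V s x - (Q ν).intWindow (Λ - 2) (V s x) with hy
  have hprojy : ∀ k, (Q ν).proj k y = if |k| ≤ (Λ : ℤ) - 2 then 0 else (Q ν).proj k (V s x) := by
    intro k
    rw [hy, map_sub, (Q ν).proj_intWindow]
    split_ifs <;> simp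
  -- Outside `[-(Λ - 2), Λ - 2]` the weight is at least its value at `Λ - 1`.
  have hlow : Real.exp (a * (Λ : ℝ) ^ (1 - r)) ^ 2 * ‖y‖ ^ 2 ≤ M s := by
    have hyw : (Q ν).intWindow Λ y = y := by
      rw [(Q ν).intWindow_eq_self_iff]
      intro k hk
      rw [hprojy, if_neg (by lia)]
      exact ((Q ν).intWindow_eq_self_iff _ _).1 (hφν s) k hk
    have h1 : ‖y‖ ^ 2 = ∑ k ∈ S, ‖(Q ν).proj k y‖ ^ 2 := by
      rw [← (Q ν).norm_sq_intWindow, hyw]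
    rw [h1, Finset.mul_sum]
    refine Finset.sum_le_sum fun k _ => ?_
    rw [hprojy]
    split_ifs with hk
    · simp only [norm_zero, ne_eq, OfNat.ofNat_ne_zero, not_false_eq_true, zero_pow, mul_zero]
      positivity
    · have hk' : (Λ : ℝ) ≤ |(k : ℝ)| + 1 := by
        have : (Λ : ℤ) ≤ |k| + 1 := by lia
        exact_mod_cast this
      unfold weight
      gcongr
  refine le_of_sq_le_sq ?_ (by positivity)
  have hG : (0 : ℝ) < Real.exp (a * (Λ : ℝ) ^ (1 - r)) ^ 2 := by positivity
  have hfin : Real.exp (a * (Λ : ℝ) ^ (1 - r)) ^ 2 * ‖y‖ ^ 2 ≤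
      Real.exp (6 * (a * (1 - r)) * χ * |s|) *
        (Real.exp (a * ((Λ₀ : ℝ) + 1) ^ (1 - r)) ^ 2 * ‖x‖ ^ 2) :=
    hlow.trans (hgron.trans (by gcongr))
  refine le_of_mul_le_mul_left (hfin.trans (le_of_eq ?_)) hG
  have hexp : Real.exp (6 * (a * (1 - r)) * χ * |s|) *
      Real.exp (a * ((Λ₀ : ℝ) + 1) ^ (1 - r)) ^ 2 = Real.exp (a * (Λ : ℝ) ^ (1 - r)) ^ 2 *
      Real.exp (3 * (a * (1 - r)) * χ * |s| +
        (a * ((Λ₀ : ℝ) + 1) ^ (1 - r) - a * (Λ : ℝ) ^ (1 - r))) ^ 2 := by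
    simp only [← Real.exp_nat_mul, ← Real.exp_add]
    congr 1
    push_cast
    ring
  rw [mul_pow, ← mul_assoc, hexp, mul_assoc]

/-- Duhamel's formula, applied twice: once for the difference of the two evolutions and once for
the difference of the generators along the truncated evolution. -/
theorem norm_sub_apply_le {U : ℝ → E →L[ℂ] E} (hU : IsEvolution H U) {Λ₀ : ℕ} (hΛ : Λ₀ < Λ)
    {x : E} (hx : windowAll Q Λ₀ x = x) {t d : ℝ} (hd0 : 0 ≤ d)
    (hd : ∀ ν s, |s| ≤ |t| → ‖V s x - (Q ν).intWindow (Λ - 2) (V s x)‖ ≤ d) :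
    ‖V t x - U t x‖ ≤ √n * ‖commutatorOn hM.selfAdjoint hdom‖ * t ^ 2 * d := by
  have hc := hM.commute
  set B := mulRight hM.selfAdjoint (windowAll Q Λ) hdom with hB
  set b := compression hM.selfAdjoint hdom with hb
  set C := commutatorOn hM.selfAdjoint hdom with hC
  have hxΛ : windowAll Q Λ x = x := intWindowAll_mono hc (by lia) hx
  have hφ : ∀ s, windowAll Q Λ (V s x) = V s x := hM.windowAll_apply_eq_self hdom hV hxΛ
  have hVd := hV.hasDerivAt_compression hM.selfAdjoint hdom x
  set A := ‖C‖ * (√n * d) with hA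
  have hA0 : 0 ≤ A := by positivity
  have hCφ : ∀ s, |s| ≤ |t| → ‖C (V s x)‖ ≤ A := by
    intro s hs
    set q := intWindowAll Q ((Λ : ℤ) - 2) with hq
    have h0 : C (q (V s x)) = 0 := hM.commutatorOn_eq_zero hdom (z := (Λ : ℤ) - 2) (by lia)
      (starProjection_idem (isStarProjection_intWindowAll hc _) _)
    have h1 : C (V s x) = C (V s x - q (V s x)) := by rw [map_sub, h0, sub_zero]
    rw [h1]
    refine (C.le_opNorm _).trans ?_
    refine mul_le_mul_of_nonneg_left ?_ (norm_nonneg _)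
    refine le_of_sq_le_sq ?_ (by positivity)
    rw [mul_pow, Real.sq_sqrt (Nat.cast_nonneg n)]
    refine (norm_sq_sub_ofFn_prod_le _ (fun ν => (Q ν).isStarProjection_intWindow _) _).trans ?_
    calc ∑ ν, ‖V s x - (Q ν).intWindow (Λ - 2) (V s x)‖ ^ 2 ≤ ∑ _ν : Fin n, d ^ 2 :=
          Finset.sum_le_sum fun ν _ => pow_le_pow_left₀ (norm_nonneg _) (hd ν s hs) 2
      _ = n * d ^ 2 := by simp
  have hw : ∀ s, HasDerivAt (fun s => V (-s) ((B - b) (V s x)))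
      (V (-s) (-Complex.I • C (V s x))) s := by
    intro s
    have h1 := ((B - b).restrictScalars ℝ).hasFDerivAt.comp_hasDerivAt s (hVd s)
    have h2 := hV.hasDerivAt_neg_apply h1
      (compression_mem_graph hM.selfAdjoint hdom ((B - b) (V s x)))
    refine h2.congr_deriv ?_
    congr 1
    change (B - b) (-Complex.I • b (V s x)) + Complex.I • b ((B - b) (V s x)) = _
    rw [hC, commutatorOn_apply _ _ (hφ s), ← hB, ← hb, map_smul]
    simp only [sub_apply, map_sub, smul_sub, neg_smul]
    abel
  have hball : Convex ℝ (Metric.closedBall (0 : ℝ) |t|) := convex_closedBall _ _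
  have hmem : ∀ {s : ℝ}, s ∈ Metric.closedBall (0 : ℝ) |t| ↔ |s| ≤ |t| := fun {s} => by
    rw [mem_closedBall_zero_iff, Real.norm_eq_abs]
  have h0mem : (0 : ℝ) ∈ Metric.closedBall (0 : ℝ) |t| := hmem.2 (by simp)
  have hBb : ∀ s, |s| ≤ |t| → ‖(B - b) (V s x)‖ ≤ A * |t| := by
    intro s hs
    have h := hball.norm_image_sub_le_of_norm_hasDerivWithin_le
      (fun u _ => (hw u).hasDerivWithinAt) (C := A) (fun u hu => by
        rw [hV.norm_apply, norm_smul, norm_neg, Complex.norm_I, one_mul]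
        exact hCφ u (hmem.1 hu)) h0mem (hmem.2 hs)
    have hz : (B - b) x = 0 := by
      rw [sub_apply, sub_eq_zero]
      exact hM.mulRight_eq_compression hdom (z := Λ₀) (by lia) hx
    simp only [neg_zero, hV.zero_apply, hz, sub_zero, hV.norm_apply,
      Real.norm_eq_abs] at h
    exact h.trans (by gcongr)
  have hy : ∀ s, HasDerivAt (fun s => U (-s) (V s x))
      (U (-s) (Complex.I • (B - b) (V s x))) s := by
    intro s
    refine (hU.hasDerivAt_neg_apply (hVd s)
      (mulRight_mem_graph_of_eq hM.selfAdjoint hdom (hφ s))).congr_deriv ?_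
    congr 1
    rw [← hB, ← hb, sub_apply, smul_sub, neg_smul]
    abel
  have h := hball.norm_image_sub_le_of_norm_hasDerivWithin_le
    (fun u _ => (hy u).hasDerivWithinAt) (C := A * |t|) (fun u hu => by
      rw [hU.norm_apply, norm_smul, Complex.norm_I, one_mul]
      exact hBb u (hmem.1 hu)) h0mem (hmem.2 le_rfl)
  simp only [neg_zero, hU.zero_apply, hV.zero_apply, sub_zero, Real.norm_eq_abs] at h
  have e : V t x - U t x = U t (U (-t) (V t x) - x) := by
    rw [map_sub, hU.self_apply_neg]
  rw [e, hU.norm_apply]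
  refine h.trans (le_of_eq ?_)
  rw [hA, mul_assoc, ← sq, sq_abs]
  ring

/-- The truncation error with explicit constants. -/
theorem norm_sub_mul_windowAll_le {U : ℝ → E →L[ℂ] E} (hU : IsEvolution H U) (hχ : 0 ≤ χ)
    (hr0 : 0 ≤ r) (hr : r < 1) {Λ₀ : ℕ} (hΛ : Λ₀ < Λ) (t : ℝ) :
    ‖(V t - U t) * windowAll Q Λ₀‖ ≤ √n * ‖commutatorOn hM.selfAdjoint hdom‖ *
      (t ^ 2 * Real.exp 2 * Real.exp (-(((Λ : ℝ) ^ (1 - r) - (Λ₀ : ℝ) ^ (1 - r)) /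
        (4 * (1 - r) * χ * |t| + 1)))) := by
  have h1r : 0 ≤ 1 - r := by linarith
  have hden : 0 ≤ 4 * (1 - r) * χ * |t| := by positivity
  -- The rate is chosen such that the Grönwall exponent stays bounded up to time `t`.
  set a := 1 / (4 * (1 - r) * χ * |t| + 1) with ha
  have ha0 : 0 ≤ a := by positivity
  have ha1 : a ≤ 1 := by
    rw [ha, div_le_one (by linarith)]; linarith
  have hat : a * (4 * (1 - r) * χ * |t|) ≤ 1 := by
    rw [ha, one_div_mul_eq_div, div_le_one (by linarith)]; linarith
  have hsub : ((Λ₀ : ℝ) + 1) ^ (1 - r) ≤ (Λ₀ : ℝ) ^ (1 - r) + 1 := by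
    have := Real.rpow_add_le_add_rpow (Nat.cast_nonneg Λ₀) zero_le_one h1r (by linarith : 1 - r ≤ 1)
    simpa using this
  set e := -(((Λ : ℝ) ^ (1 - r) - (Λ₀ : ℝ) ^ (1 - r)) / (4 * (1 - r) * χ * |t| + 1)) with he
  have he' : e = a * (Λ₀ : ℝ) ^ (1 - r) - a * (Λ : ℝ) ^ (1 - r) := by
    rw [he, ha]; ring
  refine ContinuousLinearMap.opNorm_le_bound _ (by positivity) fun x => ?_
  set y := windowAll Q Λ₀ x with hy
  have hyx : windowAll Q Λ₀ y = y := starProjection_idem (hM.isStarProjection_windowAll Λ₀) x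
  have hynorm : ‖y‖ ≤ ‖x‖ := norm_starProjection_apply_le (hM.isStarProjection_windowAll Λ₀) x
  have h := hM.norm_sub_apply_le hdom hV hU hΛ hyx (t := t) (d := Real.exp (2 + e) * ‖x‖)
    (by positivity) fun ν s hs => by
      refine (hM.norm_sub_intWindow_le hdom hV hχ hr0 hr ha0 ha1 hΛ.le hyx ν s).trans ?_
      refine mul_le_mul (Real.exp_le_exp.2 ?_) hynorm (norm_nonneg _) (Real.exp_pos _).le
      have h1 : 3 * (a * (1 - r)) * χ * |s| ≤ 3 * (a * (1 - r)) * χ * |t| := by gcongr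
      have h2 : a * ((Λ₀ : ℝ) + 1) ^ (1 - r) ≤ a * ((Λ₀ : ℝ) ^ (1 - r) + 1) := by gcongr
      rw [he']
      linarith
  change ‖V t y - U t y‖ ≤ _
  refine h.trans (le_of_eq ?_)
  rw [Real.exp_add]
  ring

end IsModel

end Leakage

/-! ### Polylogarithmic thresholds -/

section Threshold

/-- Polynomial growth of a polynomial in two variables on the positive quadrant. -/
theorem exists_eval_le (q : MvPolynomial (Fin 2) ℝ) :
    ∃ K : ℝ, 0 ≤ K ∧ ∃ m : ℕ, ∀ x y : ℝ, 0 ≤ x → 0 ≤ y →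
      |MvPolynomial.eval ![x, y] q| ≤ K * ((1 + x) * (1 + y)) ^ m := by
  induction q using MvPolynomial.induction_on with
  | C a => exact ⟨|a|, abs_nonneg a, 0, fun x y _ _ => by simp⟩
  | add p q hp hq =>
    obtain ⟨K, hK, m, h⟩ := hp
    obtain ⟨K', hK', m', h'⟩ := hq
    refine ⟨K + K', by positivity, m + m', fun x y hx hy => ?_⟩
    have hone : 1 ≤ (1 + x) * (1 + y) := by nlinarith
    rw [map_add, add_mul]
    refine (abs_add_le _ _).trans (add_le_add ((h x y hx hy).trans ?_) ((h' x y hx hy).trans ?_))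
    · gcongr
      lia
    · gcongr
      lia
  | mul_X p i hp =>
    obtain ⟨K, hK, m, h⟩ := hp
    refine ⟨K, hK, m + 1, fun x y hx hy => ?_⟩
    have hi : |(![x, y] : Fin 2 → ℝ) i| ≤ (1 + x) * (1 + y) := by
      fin_cases i
      · simp only [Fin.zero_eta, Matrix.cons_val_zero, abs_of_nonneg hx]; nlinarith
      · simp only [Fin.mk_one, Matrix.cons_val_one, Matrix.cons_val_fin_one, abs_of_nonneg hy]
        nlinarith
    rw [map_mul, MvPolynomial.eval_X, abs_mul, pow_succ, ← mul_assoc]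
    exact mul_le_mul (h x y hx hy) hi (abs_nonneg _) (by positivity)

theorem one_add_pow_mul_exp_neg_le (i : ℕ) {X : ℝ} (hX : 0 ≤ X) :
    (1 + X) ^ i * Real.exp (-X) ≤ 2 ^ i * i.factorial * Real.exp 1 * Real.exp (-(X / 2)) := by
  have h := Real.pow_div_factorial_le_exp ((1 + X) / 2) (by positivity) i
  rw [div_le_iff₀ (by positivity), div_pow, div_le_iff₀ (by positivity)] at h
  have h2 : Real.exp ((1 + X) / 2) * Real.exp (-X) ≤ Real.exp 1 * Real.exp (-(X / 2)) := by
    rw [← Real.exp_add, ← Real.exp_add]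
    exact Real.exp_le_exp.2 (by linarith)
  calc (1 + X) ^ i * Real.exp (-X)
      ≤ (Real.exp ((1 + X) / 2) * i.factorial * 2 ^ i) * Real.exp (-X) := by gcongr
    _ = 2 ^ i * i.factorial * (Real.exp ((1 + X) / 2) * Real.exp (-X)) := by ring
    _ ≤ 2 ^ i * i.factorial * (Real.exp 1 * Real.exp (-(X / 2))) := by gcongr
    _ = _ := by ring

theorem one_add_le_two_mul_one_add_rpow_pow {p x : ℝ} (hp : 0 < p) (hx : 0 ≤ x) {j : ℕ}
    (hj : 1 / p ≤ j) : 1 + x ≤ 2 * (1 + x ^ p) ^ j := by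
  have h0 : 0 ≤ x ^ p := by positivity
  have h1 : x ≤ (1 + x ^ p) ^ j :=
    calc x = (x ^ p) ^ (1 / p) := by
          rw [← Real.rpow_mul hx, mul_one_div_cancel hp.ne', Real.rpow_one]
      _ ≤ (1 + x ^ p) ^ (1 / p) := by gcongr; linarith
      _ ≤ (1 + x ^ p) ^ (j : ℝ) := Real.rpow_le_rpow_of_exponent_le (by linarith) hj
      _ = _ := Real.rpow_natCast _ _
  have h2 : 1 ≤ (1 + x ^ p) ^ j := one_le_pow₀ (by linarith)
  linarith

theorem sqrt_le_one_add {x : ℝ} (hx : 0 ≤ x) : √x ≤ 1 + x := by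
  rw [Real.sqrt_le_left (by positivity)]
  nlinarith

theorem pow_growth_le {x y B X : ℝ} (hx0 : 0 ≤ x) (hy0 : 0 ≤ y) (hx : 1 + x ≤ 3 * B) (j m : ℕ)
    (hy : 1 + y ≤ 2 * (4 * B * (1 + X)) ^ j) :
    ((1 + x) * (1 + y)) ^ m ≤ (6 * 4 ^ j) ^ m * B ^ (m + j * m) * (1 + X) ^ (j * m) :=
  calc ((1 + x) * (1 + y)) ^ m ≤ ((3 * B) * (2 * (4 * B * (1 + X)) ^ j)) ^ m := by
        have : 0 ≤ 3 * B := by linarith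
        gcongr
    _ = _ := by
        rw [pow_add, pow_mul, pow_mul, ← mul_assoc, ← mul_pow, ← mul_pow, ← mul_pow]
        congr 1
        rw [mul_pow, mul_pow]
        ring

theorem prefactor_mul_exp_le {K B X : ℝ} {i d c : ℕ} (hK : 0 ≤ K) (hB : 2 ≤ B) (hX : 0 ≤ X)
    (hc : K * (2 ^ i * i.factorial * Real.exp 1) ≤ 2 ^ c)
    (hexp : Real.exp (-(X / 2)) ≤ 1 / B ^ (d + 1 + c)) :
    K * B ^ d * ((1 + X) ^ i * Real.exp (-X)) ≤ 1 / B := by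
  have hB0 : 0 < B := by linarith
  calc K * B ^ d * ((1 + X) ^ i * Real.exp (-X))
      ≤ K * B ^ d * (2 ^ i * i.factorial * Real.exp 1 * Real.exp (-(X / 2))) := by
        exact mul_le_mul_of_nonneg_left (one_add_pow_mul_exp_neg_le _ hX) (by positivity)
    _ = K * (2 ^ i * i.factorial * Real.exp 1) * B ^ d * Real.exp (-(X / 2)) := by ring
    _ ≤ B ^ c * B ^ d * (1 / B ^ (d + 1 + c)) := by
        gcongr
        exact hc.trans (by gcongr)
    _ = 1 / B := by
        rw [pow_add, pow_add]
        field_simp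

/-- A logarithmic excess of the threshold beats every polynomial prefactor, including the
polynomial dependence on the threshold itself. -/
theorem exists_threshold {r : ℝ} (κ : ℝ) (q : MvPolynomial (Fin 2) ℝ) (hr0 : 0 ≤ r)
    (hr : r < 1) : ∃ C : ℝ, 0 < C ∧ ∀ (n N Λ₀ Λ : ℕ) (χ t T ε A : ℝ), 0 < χ → (n : ℝ) ≤ κ * N →
      1 ≤ N → 0 ≤ T → 0 < ε → ε ≤ 2 → |t| ≤ T → 0 ≤ A →
      A ≤ |MvPolynomial.eval ![(N : ℝ), (Λ : ℝ)] q| →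
      (Λ₀ : ℝ) ^ (1 - r) + C * (χ * T + 1) * Real.log (2 + N / ε + Λ₀ + T + χ * T)
        ≤ (Λ : ℝ) ^ (1 - r) →
      √n * A * (t ^ 2 * Real.exp 2 * Real.exp (-(((Λ : ℝ) ^ (1 - r) - (Λ₀ : ℝ) ^ (1 - r)) /
        (4 * (1 - r) * χ * |t| + 1)))) ≤ ε := by
  obtain ⟨K, hK, m, hq⟩ := exists_eval_le q
  have hp : 0 < 1 - r := by linarith
  obtain ⟨j, hj⟩ := exists_nat_ge (1 / (1 - r))
  set K₁ : ℝ := (1 + 2 * |κ|) * (K * (6 * 4 ^ j) ^ m) * Real.exp 2 with hK₁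
  have hK₁0 : 0 ≤ K₁ := by positivity
  obtain ⟨c, hc⟩ := pow_unbounded_of_one_lt
    (K₁ * (2 ^ (j * m) * (j * m).factorial * Real.exp 1)) one_lt_two
  -- `d` is the power of the logarithm's argument in the prefactor. One more power is needed for
  -- `1 / ε` and `c` powers absorb the constants.
  set d : ℕ := 1 + (m + j * m) + 2 with hd
  set e : ℕ := d + 1 + c with he
  refine ⟨8 * e, by positivity, ?_⟩
  intro n N Λ₀ Λ χ t T ε A hχ hn hN hT hε hε2 ht hA hAq hΛ
  have hN' : (1 : ℝ) ≤ N := by exact_mod_cast hN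
  set B : ℝ := 2 + N / ε + Λ₀ + T + χ * T with hB
  have hχT : 0 ≤ χ * T := by positivity
  have hNε : 0 ≤ N / ε := by positivity
  have hΛ₀0 : (0 : ℝ) ≤ Λ₀ := Nat.cast_nonneg _
  have hB2 : 2 ≤ B := by linarith
  have hB0 : 0 < B := by linarith
  have hNB : N ≤ 2 * B := by
    have h : N / ε ≤ B := by linarith
    rw [div_le_iff₀ hε] at h
    nlinarith
  have hεB : 1 / B ≤ ε := by
    have h : N / ε ≤ B := by linarith
    rw [div_le_iff₀ hε] at h
    rw [div_le_iff₀ hB0]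
    linarith
  have hL : 0 ≤ Real.log B := Real.log_nonneg (by linarith)
  set Y := 4 * (χ * T) + 1 with hY
  have hY0 : 0 < Y := by linarith
  set D := (Λ : ℝ) ^ (1 - r) - (Λ₀ : ℝ) ^ (1 - r) with hD
  have hDlow : 8 * e * (χ * T + 1) * Real.log B ≤ D := by linarith
  have hD0 : 0 ≤ D := le_trans (by positivity) hDlow
  set X := D / Y with hX
  have hX0 : 0 ≤ X := by positivity
  have hXlow : 2 * e * Real.log B ≤ X := by
    rw [hX, le_div_iff₀ hY0]
    refine le_trans ?_ hDlow
    have : 0 ≤ e * Real.log B := by positivity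
    nlinarith
  have hexpX : Real.exp (-(X / 2)) ≤ 1 / B ^ e := by
    rw [one_div, ← Real.exp_log (pow_pos hB0 e), ← Real.exp_neg, Real.log_pow]
    exact Real.exp_le_exp.2 (by linarith)
  have hexp : Real.exp (-(D / (4 * (1 - r) * χ * |t| + 1))) ≤ Real.exp (-X) := by
    refine Real.exp_le_exp.2 (neg_le_neg ?_)
    rw [hX]
    have h1 : χ * |t| ≤ χ * T := by gcongr
    have h2 : 0 ≤ χ * |t| := by positivity
    have h3 : 0 ≤ 4 * (1 - r) * χ * |t| := by positivity
    gcongr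
    rw [hY]
    nlinarith
  have ht2 : t ^ 2 ≤ B ^ 2 := by
    rw [← sq_abs]
    gcongr
    linarith
  have hsqrt : √n ≤ (1 + 2 * |κ|) * B := by
    have h1 := sqrt_le_one_add (Nat.cast_nonneg n : (0 : ℝ) ≤ n)
    have h2 : κ * N ≤ |κ| * (2 * B) :=
      mul_le_mul (le_abs_self κ) hNB (by positivity) (abs_nonneg κ)
    linarith
  have hΛB : 1 + (Λ : ℝ) ≤ 2 * (4 * B * (1 + X)) ^ j := by
    refine (one_add_le_two_mul_one_add_rpow_pow hp (Nat.cast_nonneg Λ) hj).trans ?_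
    have h1 : (Λ₀ : ℝ) ^ (1 - r) ≤ 1 + Λ₀ := by
      calc (Λ₀ : ℝ) ^ (1 - r) ≤ (1 + (Λ₀ : ℝ)) ^ (1 - r) := by gcongr; linarith
        _ ≤ (1 + (Λ₀ : ℝ)) ^ (1 : ℝ) :=
          Real.rpow_le_rpow_of_exponent_le (by linarith) (by linarith)
        _ = _ := Real.rpow_one _
    have h2 : D = Y * X := by rw [hX]; field_simp
    have h3 : Y ≤ 4 * B := by linarith
    have h4 : Y * X ≤ 4 * B * X := by gcongr
    gcongr
    linarith
  have hA' : A ≤ K * ((6 * 4 ^ j) ^ m * B ^ (m + j * m) * (1 + X) ^ (j * m)) := by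
    refine hAq.trans ((hq N Λ (by positivity) (by positivity)).trans ?_)
    gcongr
    exact pow_growth_le (by positivity) (by positivity) (by linarith) j m hΛB
  refine le_trans ?_ hεB
  clear_value K₁ d e X D Y B
  calc √n * A * (t ^ 2 * Real.exp 2 * Real.exp (-(D / (4 * (1 - r) * χ * |t| + 1))))
      ≤ ((1 + 2 * |κ|) * B) * (K * ((6 * 4 ^ j) ^ m * B ^ (m + j * m) * (1 + X) ^ (j * m))) *
          (B ^ 2 * Real.exp 2 * Real.exp (-X)) := by gcongr
    _ = K₁ * B ^ d * ((1 + X) ^ (j * m) * Real.exp (-X)) := by rw [hK₁, hd]; ring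
    _ ≤ 1 / B := prefactor_mul_exp_le hK₁0 hB2 hX0 hc.le (he ▸ hexpX)

end Threshold

end HamTrunc

theorem mainTheorem2 :
    (∃ c : ℝ, 0 < c ∧ ∃ p : MvPolynomial (Fin 3) ℝ,
      ∀ (E : Type u) [NormedAddCommGroup E] [InnerProductSpace ℂ E] [CompleteSpace E]
        (n : ℕ) (Q : Fin n → HamTrunc.QuantumNumber E) (χ r : ℝ) (H : E →ₗ.[ℂ] E)
        (Λ₀ Λ : ℕ) (U V : ℝ → E →L[ℂ] E),
        0 < χ → 0 ≤ r → r < 1 → HamTrunc.IsModel Q χ r H → Λ₀ < Λ →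
        (∀ ψ : E, HamTrunc.windowAll Q Λ ψ ∈ H.domain) →
        HamTrunc.IsEvolution H U →
        HamTrunc.IsEvolution (HamTrunc.truncatedHamiltonian Q H Λ) V →
        ∀ t : ℝ,
          ‖(V t - U t) * HamTrunc.windowAll Q Λ₀‖ₑ ≤
            ENNReal.ofReal (Real.sqrt n) * HamTrunc.commutatorNorm Q H Λ *
              ENNReal.ofReal (t ^ 2 * MvPolynomial.eval ![χ * |t|, (Λ₀ : ℝ), (Λ : ℝ)] p *
                Real.exp (-(c * (((Λ : ℝ) ^ (1 - r) - (Λ₀ : ℝ) ^ (1 - r)) /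
                  (4 * (1 - r) * χ * |t| + 1)))))) ∧
    (∀ (r κ : ℝ) (q : MvPolynomial (Fin 2) ℝ), 0 ≤ r → r < 1 →
      ∃ C : ℝ, 0 < C ∧ ∃ k : ℕ,
        ∀ (E : Type u) [NormedAddCommGroup E] [InnerProductSpace ℂ E] [CompleteSpace E]
          (n N : ℕ) (Q : Fin n → HamTrunc.QuantumNumber E) (χ : ℝ) (H : E →ₗ.[ℂ] E)
          (Λ₀ Λ : ℕ) (U V : ℝ → E →L[ℂ] E) (T ε : ℝ),
          0 < χ → (n : ℝ) ≤ κ * N → HamTrunc.IsModel Q χ r H → 0 ≤ T → 0 < ε →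
          (∀ ψ : E, HamTrunc.windowAll Q Λ ψ ∈ H.domain) →
          HamTrunc.IsEvolution H U →
          HamTrunc.IsEvolution (HamTrunc.truncatedHamiltonian Q H Λ) V →
          HamTrunc.commutatorNorm Q H Λ ≤
            ENNReal.ofReal (MvPolynomial.eval ![(N : ℝ), (Λ : ℝ)] q) →
          (Λ₀ : ℝ) ^ (1 - r) + C * (χ * T + 1) *
            Real.log (2 + N / ε + Λ₀ + T + χ * T) ^ k ≤ (Λ : ℝ) ^ (1 - r) →
          ∀ t : ℝ, |t| ≤ T → ‖(V t - U t) * HamTrunc.windowAll Q Λ₀‖ ≤ ε) := by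
  constructor
  · refine ⟨1, one_pos, MvPolynomial.C (Real.exp 2), ?_⟩
    intro E _ _ _ n Q χ r H Λ₀ Λ U V hχ hr0 hr hM hΛ hdom hU hV t
    have h := hM.norm_sub_mul_windowAll_le hdom hV hU hχ.le hr0 hr hΛ t
    have hA := HamTrunc.enorm_commutatorOn_le hM.selfAdjoint hdom (hM.isStarProjection_windowAll Λ)
    rw [MvPolynomial.eval_C, one_mul, ← ofReal_norm]
    refine (ENNReal.ofReal_le_ofReal h).trans ?_
    rw [ENNReal.ofReal_mul (by positivity), ENNReal.ofReal_mul (by positivity), ofReal_norm]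
    gcongr
    exact hA
  · intro r κ q hr0 hr
    obtain ⟨C, hC, hmain⟩ := HamTrunc.exists_threshold κ q hr0 hr
    refine ⟨C, hC, 1, ?_⟩
    intro E _ _ _ n N Q χ H Λ₀ Λ U V T ε hχ hn hM hT hε hdom hU hV hA hΛ t ht
    rw [pow_one] at hΛ
    have hp : 0 < 1 - r := by linarith
    have hlog : 0 < Real.log (2 + N / ε + Λ₀ + T + χ * T) := by
      refine Real.log_pos ?_
      have : 0 ≤ (N : ℝ) / ε + Λ₀ + T + χ * T := by positivity
      linarith
    have hΛlt : Λ₀ < Λ := by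
      have h0 : 0 < C * (χ * T + 1) * Real.log (2 + N / ε + Λ₀ + T + χ * T) := by positivity
      have h1 : (Λ₀ : ℝ) ^ (1 - r) < (Λ : ℝ) ^ (1 - r) := by linarith
      exact_mod_cast (Real.rpow_lt_rpow_iff (Nat.cast_nonneg _) (Nat.cast_nonneg _) hp).1 h1
    have h := hM.norm_sub_mul_windowAll_le hdom hV hU hχ.le hr0 hr hΛlt t
    -- Without modes the truncation is exact.
    rcases Nat.eq_zero_or_pos N with hN | hN
    · have hn0 : n = 0 := by
        rw [hN, Nat.cast_zero, mul_zero] at hn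
        exact_mod_cast le_antisymm hn (Nat.cast_nonneg n)
      have : ‖(V t - U t) * HamTrunc.windowAll Q Λ₀‖ ≤ 0 := by
        refine h.trans (le_of_eq ?_)
        have : √(n : ℝ) = 0 := by rw [hn0, Nat.cast_zero, Real.sqrt_zero]
        rw [this, zero_mul, zero_mul]
      exact this.trans hε.le
    rcases le_total 2 ε with hε2 | hε2
    -- Two unitaries never differ by more than `2`.
    · refine le_trans ?_ hε2
      refine ContinuousLinearMap.opNorm_le_bound _ zero_le_two fun x => ?_
      have hx := HamTrunc.norm_starProjection_apply_le (hM.isStarProjection_windowAll Λ₀) x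
      calc ‖V t (HamTrunc.windowAll Q Λ₀ x) - U t (HamTrunc.windowAll Q Λ₀ x)‖
          ≤ ‖V t (HamTrunc.windowAll Q Λ₀ x)‖ + ‖U t (HamTrunc.windowAll Q Λ₀ x)‖ :=
            norm_sub_le _ _
        _ ≤ 2 * ‖x‖ := by rw [hV.norm_apply, hU.norm_apply]; linarith
    · have hA' := (HamTrunc.enorm_commutatorOn_le hM.selfAdjoint hdom
        (hM.isStarProjection_windowAll Λ)).trans hA
      have hA'' := (hA'.trans (ENNReal.ofReal_le_ofReal (le_abs_self _)))
      rw [← ofReal_norm, ENNReal.ofReal_le_ofReal_iff (abs_nonneg _)] at hA''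
      exact h.trans (hmain n N Λ₀ Λ χ t T ε _ hχ hn hN hT hε hε2 ht (norm_nonneg _) hA'' hΛ)
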